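/- Let $V$ be a finite-dimensional complex vector space. For $n\ge 1$ put $G_n=Sp(2n,\mathbb R)$, $\Gamma_n=Sp(2n,\mathbb Z)$ and $$\mathbb H_n=\{Z\in\mathbb C^{(n,n)} : {}^tZ=Z,\ \operatorname{Im}Z>0\},\qquad g\cdot Z=(AZ+B)(CZ+D)^{-1}\quad\text{for } g=\begin{pmatrix}A&B\\C&D\end{pmatrix}\in G_n .$$ Let $(\rho_n)_{n\ge1}$ be a stable representation on $V$: each $\rho_n$ is a rational representation of $U(n)$ on $V$, extended to a rational representation $\rho_n$ of $GL(n,\mathbb C)$, and $\rho_m(A)=\rho_n\begin{pmatrix}A&0\\0&I_{n-m}\end{pmatrix}$ for all $m<n$ and $A\in U(m)$. Put $J_n(g,Z)=\rho_n(CZ+D)$. Let $[\Gamma_n,\rho_n]$ be the space of holomorphic functions $f:\mathbb H_n\to V$ with $f(\gamma\cdot Z)=J_n(\gamma,Z)f(Z)$ for all $\gamma\in\Gamma_n$, $Z\in\mathbb H_n$, which for $n=1$ are moreover bounded on every domain $\operatorname{Im}Z\ge Y_0>0$. For $f\in[\Gamma_n,\rho_n]$ and $g\in G_n$ put $(Q_nf)(g)=J_n(g,iI_n)^{-1}f(g\cdot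 iI_n)$, and let $A_h(\rho_n)$ be the image of $[\Gamma_n,\rho_n]$ under $Q_n$. For $1\le m<n$, $F\in A_h(\rho_n)$, $f\in[\Gamma_n,\rho_n]$, $g=\begin{pmatrix}A&B\\C&D\end{pmatrix}\in G_m$ and $Z\in\mathbb H_m$ set $$(L_{m,n}F)(g)=J_m(g,iI_m)^{-1}\lim_{t\to\infty}J_n(g_t,iI_n)F(g_t),\qquad g_t=\begin{pmatrix}A&0&B&0\\0&t^{1/2}I_{n-m}&0&0\\C&0&D&0\\0&0&0&t^{-1/2}I_{n-m}\end{pmatrix}\in G_n\quad(t>0),$$ $$(\Phi_{m,n}f)(Z)=\lim_{t\to\infty}f\begin{pmatrix}Z&0\\0&itI_{n-m}\end{pmatrix}.$$ **Proposition 4.1.** Let $1\le m<n$. The limit defining $(L_{m,n}F)(g)$ exists for all $F\in A_h(\rho_n)$ and $g\in G_m$, and $L_{m,n}$ is a linear map of $A_h(\rho_n)$ into $A_h(\rho_m)$. Moreover, the limit defining $(\Phi_{m,n}f)(Z)$ exists for all $f\in[\Gamma_n,\rho_n]$ and $Z\in\mathbb H_m$, $\Phi_{m,n}$ is a linear map of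 $[\Gamma_n,\rho_n]$ into $[\Gamma_m,\rho_m]$, and $L_{m,n}\circ Q_n=Q_m\circ\Phi_{m,n}$ on $[\Gamma_n,\rho_n]$. -/

import Mathlib

open Matrix Filter Topology

namespace StableSiegel

noncomputable section

open scoped ComplexOrder

/-- The complex vector space of symmetric complex `n × n` matrices. -/
def SymMat (n : ℕ) : Submodule ℂ (Matrix (Fin n) (Fin n) ℂ) where
  carrier := {Z | Z.IsSymm}
  add_mem' := fun ha hb => ha.add hb
  zero_mem' := Matrix.isSymm_zero
  smul_mem' := fun c _ hx => hx.smul c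

/-- The Siegel upper half plane `ℍ_n`: complex matrices `Z = ᵗZ` with `Im Z > 0`. -/
def SiegelH (n : ℕ) : Set (Matrix (Fin n) (Fin n) ℂ) :=
  {Z | Z.IsSymm ∧ (Z.map Complex.im).PosDef}

/-- `G_n = Sp(2n, ℝ)`. -/
abbrev Sp (n : ℕ) := Matrix.symplecticGroup (Fin n) ℝ

/-- The inclusion of the Siegel modular group `Γ_n = Sp(2n, ℤ)` into `G_n`. -/
def ofInt {n : ℕ} (γ : Matrix.symplecticGroup (Fin n) ℤ) : Sp n :=
  ⟨γ.1.map (Int.castRingHom ℝ), SymplecticGroup.map_mem γ.2 (Int.castRingHom ℝ)⟩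

/-- `A Z + B` for `g = (A B; C D)`. -/
def num {n : ℕ} (g : Sp n) (Z : Matrix (Fin n) (Fin n) ℂ) : Matrix (Fin n) (Fin n) ℂ :=
  g.1.toBlocks₁₁.map Complex.ofRealHom * Z + g.1.toBlocks₁₂.map Complex.ofRealHom

/-- `C Z + D` for `g = (A B; C D)`. -/
def denom {n : ℕ} (g : Sp n) (Z : Matrix (Fin n) (Fin n) ℂ) : Matrix (Fin n) (Fin n) ℂ :=
  g.1.toBlocks₂₁.map Complex.ofRealHom * Z + g.1.toBlocks₂₂.map Complex.ofRealHom

lemma block_relations {n : ℕ} (g : Sp n) :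
    g.1.toBlocks₁₁ᵀ * g.1.toBlocks₂₁ = g.1.toBlocks₂₁ᵀ * g.1.toBlocks₁₁ ∧
    g.1.toBlocks₁₂ᵀ * g.1.toBlocks₂₂ = g.1.toBlocks₂₂ᵀ * g.1.toBlocks₁₂ ∧
    g.1.toBlocks₁₁ᵀ * g.1.toBlocks₂₂ - g.1.toBlocks₂₁ᵀ * g.1.toBlocks₁₂ = 1 := by
  rw [← SymplecticGroup.fromBlocks_mem_iff, fromBlocks_toBlocks]
  exact g.2

/-- The common computation behind symmetry and positivity of `g · Z`. -/
lemma num_denom_aux {n : ℕ} (g : Sp n) (W Z : Matrix (Fin n) (Fin n) ℂ) (hW : W.IsSymm) :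
    (num g W)ᵀ * denom g Z - (denom g W)ᵀ * num g Z = W - Z := by
  obtain ⟨h1, h2, h3⟩ := block_relations g
  have h4 : g.1.toBlocks₂₂ᵀ * g.1.toBlocks₁₁ - g.1.toBlocks₁₂ᵀ * g.1.toBlocks₂₁ = 1 := by
    have := congrArg transpose h3
    simpa [transpose_sub, transpose_mul] using this
  have c1 := congrArg (fun M => M.map Complex.ofRealHom) h1
  have c2 := congrArg (fun M => M.map Complex.ofRealHom) h2
  have c3 := congrArg (fun M => M.map Complex.ofRealHom) h3
  have c4 := congrArg (fun M => M.map Complex.ofRealHom) h4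
  simp only [Matrix.map_mul, Matrix.map_sub Complex.ofRealHom (map_sub _),
    Matrix.map_one Complex.ofRealHom (map_zero _) (map_one _), transpose_map] at c1 c2 c3 c4
  simp only [num, denom, transpose_add, transpose_mul, hW.eq]
  rw [← transpose_map, ← transpose_map, ← transpose_map, ← transpose_map]
  simp only [transpose_map]
  set A := g.1.toBlocks₁₁.map Complex.ofRealHom
  set B := g.1.toBlocks₁₂.map Complex.ofRealHom
  set C := g.1.toBlocks₂₁.map Complex.ofRealHom
  set D := g.1.toBlocks₂₂.map Complex.ofRealHom
  have e : (W * Aᵀ + Bᵀ) * (C * Z + D) - (W * Cᵀ + Dᵀ) * (A * Z + B) =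
      W * (Aᵀ * C - Cᵀ * A) * Z + W * (Aᵀ * D - Cᵀ * B) - (Dᵀ * A - Bᵀ * C) * Z
        + (Bᵀ * D - Dᵀ * B) := by
    noncomm_ring
  rw [e, c1, c2, c3, c4]
  simp

lemma map_star_num {n : ℕ} (g : Sp n) (Z : Matrix (Fin n) (Fin n) ℂ) :
    (num g Z)ᴴ = (num g (Z.map star))ᵀ := by
  ext i j
  simp [num, Matrix.mul_apply]

lemma map_star_denom {n : ℕ} (g : Sp n) (Z : Matrix (Fin n) (Fin n) ℂ) :
    (denom g Z)ᴴ = (denom g (Z.map star))ᵀ := by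
  ext i j
  simp [denom, Matrix.mul_apply]

/-- A real matrix is positive definite iff it is so as a complex matrix. -/
lemma posDef_map_ofReal {n : ℕ} (Y : Matrix (Fin n) (Fin n) ℝ) :
    (Y.map Complex.ofRealHom).PosDef ↔ Y.PosDef := by
  constructor
  · intro h
    refine PosDef.of_dotProduct_mulVec_pos ?_ fun x hx => ?_
    · ext i j
      have := h.1.apply i j
      simpa using this
    · have hx' : (fun i => (x i : ℂ)) ≠ 0 := by
        intro h0; apply hx; ext i; simpa using congrFun h0 i
      have := h.dotProduct_mulVec_pos hx'
      have e : star (fun i => (x i : ℂ)) ⬝ᵥ (Y.map Complex.ofRealHom) *ᵥ (fun i => (x i : ℂ))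
          = ((star x ⬝ᵥ Y *ᵥ x : ℝ) : ℂ) := by
        simp [dotProduct, mulVec]
      rw [e] at this
      exact_mod_cast this
  · intro h
    have hs : ∀ i j, Y j i = Y i j := fun i j => by simpa using h.1.apply i j
    refine PosDef.of_dotProduct_mulVec_pos ?_ fun v hv => ?_
    · ext i j
      simp [hs]
    · set a : Fin n → ℝ := fun i => (v i).re
      set b : Fin n → ℝ := fun i => (v i).im
      have e : star v ⬝ᵥ (Y.map Complex.ofRealHom) *ᵥ v
          = ((star a ⬝ᵥ Y *ᵥ a + star b ⬝ᵥ Y *ᵥ b : ℝ) : ℂ) := by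
        have key : ∀ x y : Fin n → ℝ, x ⬝ᵥ Y *ᵥ y = y ⬝ᵥ Y *ᵥ x := by
          intro x y
          have hY : Yᵀ = Y := by ext i j; exact hs i j
          rw [dotProduct_mulVec, dotProduct_comm, ← mulVec_transpose, hY]
        apply Complex.ext
        · simp [dotProduct, mulVec, a, b, Finset.sum_add_distrib]
        · have := key a b
          simp only [dotProduct, mulVec, a, b] at this
          simp [dotProduct, mulVec, Finset.sum_add_distrib, this]
      rw [e]
      have ha : 0 ≤ star a ⬝ᵥ Y *ᵥ a := h.posSemidef.dotProduct_mulVec_nonneg a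
      have hb : 0 ≤ star b ⬝ᵥ Y *ᵥ b := h.posSemidef.dotProduct_mulVec_nonneg b
      have : 0 < star a ⬝ᵥ Y *ᵥ a + star b ⬝ᵥ Y *ᵥ b := by
        by_cases h0 : a = 0
        · have hb0 : b ≠ 0 := by
            intro hb0
            apply hv
            ext i
            exact Complex.ext (by simpa using congrFun h0 i) (by simpa using congrFun hb0 i)
          have := h.dotProduct_mulVec_pos hb0
          linarith
        · have := h.dotProduct_mulVec_pos h0
          linarith
      exact_mod_cast this

lemma map_star_sub {n : ℕ} (Z : Matrix (Fin n) (Fin n) ℂ) :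
    Z - Z.map star = (2 * Complex.I) • (Z.map Complex.im).map Complex.ofRealHom := by
  ext i j
  apply Complex.ext <;> simp
  ring

lemma num_denom_im {n : ℕ} (g : Sp n) (Z : Matrix (Fin n) (Fin n) ℂ) (hZ : Z.IsSymm) :
    (denom g Z)ᴴ * num g Z - (num g Z)ᴴ * denom g Z =
      (2 * Complex.I) • (Z.map Complex.im).map Complex.ofRealHom := by
  have := num_denom_aux g (Z.map star) Z (hZ.map star)
  rw [← map_star_sub, map_star_num, map_star_denom, ← neg_sub, this, neg_sub]

lemma denom_det_ne_zero {n : ℕ} (g : Sp n) (Z : SiegelH n) : (denom g Z.1).det ≠ 0 := by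
  intro h0
  obtain ⟨v, hv, hv0⟩ := Matrix.exists_mulVec_eq_zero_iff.mpr h0
  have h := congrArg (fun M => star v ⬝ᵥ M *ᵥ v) (num_denom_im g Z.1 Z.2.1)
  have hp := ((posDef_map_ofReal _).2 Z.2.2).dotProduct_mulVec_pos hv
  have h1 : star v ⬝ᵥ ((denom g Z.1)ᴴ * num g Z.1) *ᵥ v = 0 := by
    rw [← mulVec_mulVec, dotProduct_mulVec, ← star_mulVec, hv0]
    simp
  have h2 : star v ⬝ᵥ ((num g Z.1)ᴴ * denom g Z.1) *ᵥ v = 0 := by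
    rw [← mulVec_mulVec, hv0]
    simp
  simp only [sub_mulVec, dotProduct_sub, h1, h2, smul_mulVec, dotProduct_smul, sub_zero,
    smul_eq_mul] at h
  rcases mul_eq_zero.1 h.symm with h | h
  · simp at h
  · exact hp.ne' h

/-- `C Z + D` as an element of `GL(n, ℂ)`. -/
def denomGL {n : ℕ} (g : Sp n) (Z : SiegelH n) : GL (Fin n) ℂ :=
  Matrix.GeneralLinearGroup.mkOfDetNeZero (denom g Z.1) (denom_det_ne_zero g Z)

lemma act_mem {n : ℕ} (g : Sp n) (Z : SiegelH n) :
    num g Z.1 * (denom g Z.1)⁻¹ ∈ SiegelH n := by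
  have hd : IsUnit (denom g Z.1).det := (denom_det_ne_zero g Z).isUnit
  have hs := num_denom_aux g Z.1 Z.1 Z.2.1
  have hi := num_denom_im g Z.1 Z.2.1
  set P := num g Z.1
  set R := denom g Z.1
  have hdT : IsUnit Rᵀ.det := by rwa [det_transpose]
  have hdH : IsUnit Rᴴ.det := by rw [det_conjTranspose]; exact hd.star
  have hsym : (P * R⁻¹).IsSymm := by
    rw [sub_self, sub_eq_zero] at hs
    rw [IsSymm, transpose_mul, transpose_nonsing_inv]
    calc Rᵀ⁻¹ * Pᵀ = Rᵀ⁻¹ * (Pᵀ * R) * R⁻¹ := by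
          rw [Matrix.mul_assoc, Matrix.mul_assoc, mul_nonsing_inv R hd, Matrix.mul_one]
      _ = P * R⁻¹ := by
          rw [hs, ← Matrix.mul_assoc, nonsing_inv_mul _ hdT, Matrix.one_mul]
  refine ⟨hsym, ?_⟩
  rw [← posDef_map_ofReal]
  have e : (2 * Complex.I) • ((P * R⁻¹).map Complex.im).map Complex.ofRealHom
      = (2 * Complex.I) • (R⁻¹ᴴ * (Z.1.map Complex.im).map Complex.ofRealHom * R⁻¹) := by
    rw [← map_star_sub]
    have hc : (P * R⁻¹).map star = (P * R⁻¹)ᴴ := by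
      rw [conjTranspose, hsym.eq]
    rw [hc, ← Matrix.smul_mul, ← Matrix.mul_smul, ← hi, conjTranspose_mul, conjTranspose_nonsing_inv]
    simp only [Matrix.mul_sub, Matrix.sub_mul]
    congr 1
    · rw [← Matrix.mul_assoc Rᴴ⁻¹, nonsing_inv_mul _ hdH, Matrix.one_mul]
    · rw [← Matrix.mul_assoc Rᴴ⁻¹, Matrix.mul_assoc _ R, mul_nonsing_inv _ hd, Matrix.mul_one]
  have e' := smul_right_injective _ (show 2 * Complex.I ≠ 0 by simp) e
  rw [e']
  refine ((posDef_map_ofReal _).2 Z.2.2).conjTranspose_mul_mul_same ?_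
  apply mulVec_injective_of_isUnit
  exact (isUnit_iff_isUnit_det _).2 (by simpa using hd)

/-- The action `g · Z = (A Z + B)(C Z + D)⁻¹` of `G_n` on `ℍ_n`. -/
def act {n : ℕ} (g : Sp n) (Z : SiegelH n) : SiegelH n :=
  ⟨num g Z.1 * (denom g Z.1)⁻¹, act_mem g Z⟩

/-- The base point `i I_n`. -/
def basePt (n : ℕ) : SiegelH n :=
  ⟨Complex.I • (1 : Matrix (Fin n) (Fin n) ℂ), by
    refine ⟨Matrix.isSymm_one.smul _, ?_⟩
    have : (Complex.I • (1 : Matrix (Fin n) (Fin n) ℂ)).map Complex.im = 1 := by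
      ext i j
      by_cases h : i = j <;> simp [h, Matrix.one_apply]
    rw [this]
    exact Matrix.PosDef.one⟩

/-- The order preserving splitting of `{0, …, n-1}` into its first `m` and its last `n - m`
elements. -/
def splitEquiv {m n : ℕ} (h : m < n) : Fin m ⊕ Fin (n - m) ≃ Fin n :=
  finSumFinEquiv.trans (finCongr (Nat.add_sub_of_le h.le))

/-- The `n × n` matrix `(X 0; 0 Y)` with `X` of size `m` and `Y` of size `n - m`. -/
def blk {R : Type*} [Zero R] {m n : ℕ} (h : m < n) (X : Matrix (Fin m) (Fin m) R)
    (Y : Matrix (Fin (n - m)) (Fin (n - m)) R) : Matrix (Fin n) (Fin n) R :=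
  Matrix.reindex (splitEquiv h) (splitEquiv h) (Matrix.fromBlocks X 0 0 Y)

section blk

variable {R : Type*} [CommRing R] {m n : ℕ} (h : m < n)

lemma blk_mul (X X' : Matrix (Fin m) (Fin m) R) (Y Y' : Matrix (Fin (n - m)) (Fin (n - m)) R) :
    blk h X Y * blk h X' Y' = blk h (X * X') (Y * Y') := by
  simp [blk, Matrix.submatrix_mul_equiv, Matrix.fromBlocks_multiply]

lemma blk_sub (X X' : Matrix (Fin m) (Fin m) R) (Y Y' : Matrix (Fin (n - m)) (Fin (n - m)) R) :
    blk h X Y - blk h X' Y' = blk h (X - X') (Y - Y') := by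
  ext i j
  rcases hi : (splitEquiv h).symm i with a | a <;> rcases hj : (splitEquiv h).symm j with b | b <;>
    simp [blk, hi, hj]

lemma blk_transpose (X : Matrix (Fin m) (Fin m) R) (Y : Matrix (Fin (n - m)) (Fin (n - m)) R) :
    (blk h X Y)ᵀ = blk h Xᵀ Yᵀ := by
  simp [blk, Matrix.fromBlocks_transpose]

lemma blk_one : blk h (1 : Matrix (Fin m) (Fin m) R) 1 = 1 := by
  simp [blk]

end blk

/-- The embedding `A ↦ (A 0; 0 I_{n-m})` of `GL(m, ℂ)` into `GL(n, ℂ)`. -/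
def embGL {m n : ℕ} (h : m < n) (A : GL (Fin m) ℂ) : GL (Fin n) ℂ where
  val := blk h (A : Matrix (Fin m) (Fin m) ℂ) 1
  inv := blk h ((A⁻¹ : GL (Fin m) ℂ) : Matrix (Fin m) (Fin m) ℂ) 1
  val_inv := by rw [blk_mul, Units.mul_inv, one_mul, blk_one]
  inv_val := by rw [blk_mul, Units.inv_mul, one_mul, blk_one]

/-- The point `(Z 0; 0 i t I_{n-m})` of `ℍ_n`, for `Z ∈ ℍ_m` and `t > 0`. -/
def embPt {m n : ℕ} (h : m < n) (Z : SiegelH m) (t : Set.Ioi (0 : ℝ)) : SiegelH n :=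
  ⟨blk h Z.1 ((Complex.I * (t.1 : ℂ)) • 1), by
    refine ⟨?_, ?_⟩
    · rw [Matrix.IsSymm, blk_transpose, Z.2.1.eq, transpose_smul, transpose_one]
    · have e : (blk h Z.1 ((Complex.I * (t.1 : ℂ)) • 1)).map Complex.im =
          (Matrix.fromBlocks (Z.1.map Complex.im) 0 0 (t.1 • 1)).submatrix
            (splitEquiv h).symm (splitEquiv h).symm := by
        ext i j
        rcases hi : (splitEquiv h).symm i with a | a <;>
          rcases hj : (splitEquiv h).symm j with b | b <;>
          simp [blk, hi, hj, Matrix.one_apply]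
        split_ifs <;> simp
      rw [e]
      refine Matrix.PosDef.submatrix ?_ (splitEquiv h).symm.injective
      have hX := Z.2.2
      have hY : (t.1 • (1 : Matrix (Fin (n - m)) (Fin (n - m)) ℝ)).PosDef :=
        Matrix.PosDef.one.smul t.2
      refine PosDef.of_dotProduct_mulVec_pos ?_ fun x hx => ?_
      · exact Matrix.IsHermitian.fromBlocks hX.1 (by simp) hY.1
      · have hx' : (fun i => x (Sum.inl i)) ≠ 0 ∨ (fun i => x (Sum.inr i)) ≠ 0 := by
          by_contra! hc
          apply hx
          ext i
          rcases i with i | i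
          · exact congrFun hc.1 i
          · exact congrFun hc.2 i
        have e2 : star x ⬝ᵥ Matrix.fromBlocks (Z.1.map Complex.im) 0 0 (t.1 • 1) *ᵥ x =
            star (fun i => x (Sum.inl i)) ⬝ᵥ (Z.1.map Complex.im) *ᵥ (fun i => x (Sum.inl i)) +
            star (fun i => x (Sum.inr i)) ⬝ᵥ
              (t.1 • (1 : Matrix (Fin (n - m)) (Fin (n - m)) ℝ)) *ᵥ
                (fun i => x (Sum.inr i)) := by
          simp [dotProduct, mulVec, Fintype.sum_sum_type]
        rw [e2]
        have p1 := hX.posSemidef.dotProduct_mulVec_nonneg (fun i => x (Sum.inl i))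
        have p2 := hY.posSemidef.dotProduct_mulVec_nonneg (fun i => x (Sum.inr i))
        rcases hx' with h1 | h1
        · have := hX.dotProduct_mulVec_pos h1
          linarith
        · have := hY.dotProduct_mulVec_pos h1
          linarith⟩

/-- The element `g_t` of `G_n` attached to `g = (A B; C D) ∈ G_m` and `t > 0`; it has the blocks
`(A 0; 0 t^{1/2} I)`, `(B 0; 0 0)`, `(C 0; 0 0)`, `(D 0; 0 t^{-1/2} I)`. -/
def embSp {m n : ℕ} (h : m < n) (g : Sp m) (t : Set.Ioi (0 : ℝ)) : Sp n :=
  ⟨Matrix.fromBlocks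
      (blk h g.1.toBlocks₁₁ (Real.sqrt t.1 • 1)) (blk h g.1.toBlocks₁₂ 0)
      (blk h g.1.toBlocks₂₁ 0) (blk h g.1.toBlocks₂₂ ((Real.sqrt t.1)⁻¹ • 1)), by
    obtain ⟨h1, h2, h3⟩ := block_relations g
    have ht : Real.sqrt t.1 ≠ 0 := (Real.sqrt_pos.2 t.2).ne'
    rw [SymplecticGroup.fromBlocks_mem_iff]
    simp only [blk_transpose, blk_mul, blk_sub, h1, h2, h3]
    refine ⟨by simp, by simp, ?_⟩
    simp [ht, smul_smul, blk_one]⟩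

lemma extend_apply {W : Type*} [Zero W] {n : ℕ} (f : SiegelH n → W) {Z : Matrix (Fin n) (Fin n) ℂ}
    (hZ : Z ∈ SiegelH n) :
    Function.extend (Subtype.val : SiegelH n → _) f 0 Z = f ⟨Z, hZ⟩ :=
  Subtype.val_injective.extend_apply f 0 ⟨Z, hZ⟩

variable {V : Type*} [NormedAddCommGroup V] [NormedSpace ℂ V]

/-- A representation of `GL(n, ℂ)` on `V` is rational if its matrix coefficients are polynomials
in the entries of the matrix and the inverse of the determinant. -/
def IsRational {n : ℕ} (ρ : GL (Fin n) ℂ →* (V ≃ₗ[ℂ] V)) : Prop :=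
  ∀ (φ : Module.Dual ℂ V) (v : V), ∃ (P : MvPolynomial (Fin n × Fin n) ℂ) (k : ℕ),
    ∀ A : GL (Fin n) ℂ,
      φ (ρ A v) = MvPolynomial.eval (fun p => (A : Matrix (Fin n) (Fin n) ℂ) p.1 p.2) P
        / (A : Matrix (Fin n) (Fin n) ℂ).det ^ k

variable (V) in
/-- A stable representation of `U(∞)` on `V`: a sequence of rational representations `ρ_n` of
`K_n = U(n)`, each given together with its extension to the complexification `GL(n, ℂ)`, such that
`ρ_m(A) = ρ_n(A 0; 0 I_{n-m})` for all `A ∈ U(m)` and `m < n`.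
The index `n = 0` adds nothing: `GL(0, ℂ)` is trivial, so `ρ_0` is trivial. -/
structure StableRep where
  rep : ∀ n : ℕ, GL (Fin n) ℂ →* (V ≃ₗ[ℂ] V)
  rational : ∀ n, IsRational (rep n)
  compat : ∀ {m n : ℕ} (h : m < n) (A : GL (Fin m) ℂ),
    (A : Matrix (Fin m) (Fin m) ℂ) ∈ Matrix.unitaryGroup (Fin m) ℂ →
      rep m A = rep n (embGL h A)

/-- The automorphic factor `J_n(g, Z) = ρ_n(C Z + D) ∈ GL(V)`. -/
def autJ {n : ℕ} (ρ : GL (Fin n) ℂ →* (V ≃ₗ[ℂ] V)) (g : Sp n) (Z : SiegelH n) : V ≃ₗ[ℂ] V :=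
  ρ (denomGL g Z)

/-- `f : ℍ_n → V` is holomorphic: it is complex differentiable on `ℍ_n` as an open subset of the
complex vector space of symmetric matrices. -/
def IsHolo {n : ℕ} (f : SiegelH n → V) : Prop :=
  DifferentiableOn ℂ
    (fun Z : SymMat n => Function.extend (Subtype.val : SiegelH n → _) f 0
      (Z : Matrix (Fin n) (Fin n) ℂ))
    {Z : SymMat n | (Z : Matrix (Fin n) (Fin n) ℂ) ∈ SiegelH n}

section holo

attribute [local instance] Matrix.normedAddCommGroup Matrix.normedSpace

lemma IsHolo.zero {n : ℕ} : IsHolo (0 : SiegelH n → V) :=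
  (differentiableOn_const (0 : V)).congr fun Z hZ => by
    rw [extend_apply _ hZ]; rfl

lemma IsHolo.add {n : ℕ} {f f' : SiegelH n → V} (hf : IsHolo f) (hf' : IsHolo f') :
    IsHolo (f + f') :=
  (DifferentiableOn.add hf hf').congr fun Z hZ => by
    simp only [Pi.add_apply, extend_apply _ hZ]

lemma IsHolo.smul {n : ℕ} (c : ℂ) {f : SiegelH n → V} (hf : IsHolo f) : IsHolo (c • f) :=
  (DifferentiableOn.const_smul hf c).congr fun Z hZ => by
    simp only [Pi.smul_apply, extend_apply _ hZ]

end holo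

/-- `f` is bounded in every domain `Im Z ≥ Y₀ > 0`. -/
def BoundedOnDomains {n : ℕ} (f : SiegelH n → V) : Prop :=
  ∀ Y₀ : Matrix (Fin n) (Fin n) ℝ, Y₀.PosDef →
    ∃ C : ℝ, ∀ Z : SiegelH n, (Z.1.map Complex.im - Y₀).PosSemidef → ‖f Z‖ ≤ C

/-- The vector space `[Γ_n, ρ_n]` of Siegel modular forms of type `ρ_n`. -/
def modForms {n : ℕ} (ρ : GL (Fin n) ℂ →* (V ≃ₗ[ℂ] V)) : Submodule ℂ (SiegelH n → V) where
  carrier := {f | IsHolo f ∧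
    (∀ (γ : Matrix.symplecticGroup (Fin n) ℤ) (Z : SiegelH n),
      f (act (ofInt γ) Z) = autJ ρ (ofInt γ) Z (f Z)) ∧
    (n = 1 → BoundedOnDomains f)}
  zero_mem' := ⟨IsHolo.zero, fun γ Z => by simp, fun _ Y₀ _ => ⟨0, fun Z _ => by simp⟩⟩
  add_mem' := by
    rintro f f' ⟨h1, h2, h3⟩ ⟨h1', h2', h3'⟩
    refine ⟨h1.add h1', fun γ Z => by simp [h2, h2'], fun hn Y₀ hY => ?_⟩
    obtain ⟨C, hC⟩ := h3 hn Y₀ hY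
    obtain ⟨C', hC'⟩ := h3' hn Y₀ hY
    exact ⟨C + C', fun Z hZ => (norm_add_le _ _).trans (add_le_add (hC Z hZ) (hC' Z hZ))⟩
  smul_mem' := by
    rintro c f ⟨h1, h2, h3⟩
    refine ⟨h1.smul c, fun γ Z => by simp [h2], fun hn Y₀ hY => ?_⟩
    obtain ⟨C, hC⟩ := h3 hn Y₀ hY
    refine ⟨‖c‖ * C, fun Z hZ => ?_⟩
    rw [Pi.smul_apply, norm_smul]
    exact mul_le_mul_of_nonneg_left (hC Z hZ) (norm_nonneg c)

/-- The map `Q_n`: `(Q_n f)(g) = J_n(g, i I_n)⁻¹ f(g · i I_n)`. -/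
def Q {n : ℕ} (ρ : GL (Fin n) ℂ →* (V ≃ₗ[ℂ] V)) : modForms ρ →ₗ[ℂ] (Sp n → V) where
  toFun f g := (autJ ρ g (basePt n)).symm (f.1 (act g (basePt n)))
  map_add' f f' := by ext g; simp
  map_smul' c f := by ext g; simp

/-- `A_h(ρ_n)`, the image of `[Γ_n, ρ_n]` under `Q_n`. -/
def Ah {n : ℕ} (ρ : GL (Fin n) ℂ →* (V ≃ₗ[ℂ] V)) : Submodule ℂ (Sp n → V) :=
  LinearMap.range (Q ρ)

/-- `Q_n` as a linear map onto `A_h(ρ_n)`. -/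
def QAh {n : ℕ} (ρ : GL (Fin n) ℂ →* (V ≃ₗ[ℂ] V)) : modForms ρ →ₗ[ℂ] Ah ρ :=
  (Q ρ).rangeRestrict

/-- The function `t ↦ J_n(g_t, i I_n) F(g_t)`, `t > 0`, whose limit as `t → ∞` enters the
definition of `L_{m,n} F` at `g ∈ G_m`. -/
def limitTerm {m n : ℕ} (h : m < n) (ρ : GL (Fin n) ℂ →* (V ≃ₗ[ℂ] V)) (F : Sp n → V) (g : Sp m)
    (t : Set.Ioi (0 : ℝ)) : V :=
  autJ ρ (embSp h g t) (basePt n) (F (embSp h g t))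

/-- The Siegel operator `L_{m,n}` on functions on `G_n`:
`(L_{m,n} F)(g) = J_m(g, i I_m)⁻¹ lim_{t → ∞} J_n(g_t, i I_n) F(g_t)`. -/
def siegelL {m n : ℕ} (h : m < n) (ρ : StableRep V) (F : Sp n → V) (g : Sp m) : V :=
  (autJ (ρ.rep m) g (basePt m)).symm (limUnder atTop (limitTerm h (ρ.rep n) F g))

/-- The classical Siegel operator: `(Φ_{m,n} f)(Z) = lim_{t → ∞} f(Z 0; 0 i t I_{n-m})`. -/
def siegelPhi {m n : ℕ} (h : m < n) (f : SiegelH n → V) (Z : SiegelH m) : V :=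
  limUnder atTop (fun t : Set.Ioi (0 : ℝ) => f (embPt h Z t))

end

end StableSiegel

/-! Both statements reduce to the convergence of `f (embPt h Z t)`, because the automorphy factor in
`Q` cancels the one in the definition of `L` and `g_t · i I_n` is the point `(g · i I_m, i t I)`
(`act_embSp`, `limitTerm_Q`). Since `0 < m < n` forces `n ≥ 2`, convergence is Koecher's principle.

Koecher's principle is proved without the full Fourier expansion over symmetric matrices, using only
expansions in one variable `w`. Put `M = E_jl Y + Y E_lj`, the linear term of `b ↦ U_b Y U_bᵗ` for
the transvection `U_b = 1 + b E_jl`. For `p < 0` the `p`-th coefficient of `w ↦ F (Z + ζ M + w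
E_jj)` is entire in `ζ`. Reducing `Im ζ` modulo integral transvections bounds it by a Gaussian in
`Im ζ` times an exponential, so it is constant by Liouville and tends to zero: `fc_single_eq_zero`.
Hence `F` is bounded along each `E_jj`, and Phragmén–Lindelöf turns this into a maximum principle: a
bound on a slice `Im Z = Y` survives any increase of the diagonal
(`KoecherData.norm_le_add_diagonal`). Boundedness along `diag(0, 1)` then kills the negative
coefficients in that direction, and the function converges exponentially fast to its constant term
(`KoecherData.tendsto_diagonal`).

The constant term is an integral over a fixed segment, hence holomorphic in `Z`. Its modularity
comes from embedding `Γ_m` into `Γ_n`; this needs `ρ_m(A) = ρ_n(A 0; 0 I)` for all invertible `A`,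
not only unitary ones, which is Weyl's unitarian trick (`StableRep.compat_GL`). For `m = 1` the
growth condition follows from the same maximum principle. -/

namespace StableSiegel

/-! ### Fourier expansions on half planes and Phragmén–Lindelöf. -/

section FourierCoefficients

variable {V : Type*} [NormedAddCommGroup V] [NormedSpace ℂ V]

/-- The `p`-th Fourier coefficient of a `1`-periodic function on a half plane `Im w > a`, computed
on the horizontal line of height `y`. -/
noncomputable def fc (g : ℂ → V) (p : ℤ) (y : ℝ) : V :=
  ∫ x in (0 : ℝ)..1, Complex.exp (-(2 * Real.pi * Complex.I * p * (x + y * Complex.I))) •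
    g (x + y * Complex.I)

lemma norm_exp_coeff (p : ℤ) (x y : ℝ) :
    ‖Complex.exp (-(2 * Real.pi * Complex.I * p * (x + y * Complex.I)))‖
      = Real.exp (2 * Real.pi * p * y) := by
  rw [Complex.norm_exp]
  congr 1
  simp

lemma norm_fc_le (g : ℂ → V) (p : ℤ) (y C : ℝ)
    (hC : ∀ x : ℝ, ‖g (x + y * Complex.I)‖ ≤ C) :
    ‖fc g p y‖ ≤ Real.exp (2 * Real.pi * p * y) * C := by
  have := intervalIntegral.norm_integral_le_of_norm_le_const (a := 0) (b := 1)
    (f := fun x : ℝ => Complex.exp (-(2 * Real.pi * Complex.I * p * (x + y * Complex.I))) •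
      g (x + y * Complex.I)) (C := Real.exp (2 * Real.pi * p * y) * C) (fun x _ => by
      rw [norm_smul, norm_exp_coeff]
      exact mul_le_mul_of_nonneg_left (hC x) (Real.exp_pos _).le)
  simpa [fc] using this

/-- Cauchy's theorem on the rectangle with corners `i y` and `1 + i y'`: the vertical sides cancel
because the integrand has period one. -/
lemma fc_eq_of_le {g : ℂ → V} {a : ℝ} (hg : DifferentiableOn ℂ g {w | a < w.im})
    (hp : ∀ w : ℂ, a < w.im → g (w + 1) = g w) (p : ℤ) {y y' : ℝ} (hy : a < y) (hyy' : y ≤ y') :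
    fc g p y = fc g p y' := by
  set k : ℂ → V := fun w => Complex.exp (-(2 * Real.pi * Complex.I * p * w)) • g w with hk
  have hd : DifferentiableOn ℂ k (Set.uIcc ((y : ℂ) * Complex.I).re (1 + (y' : ℂ) * Complex.I).re ×ℂ
        Set.uIcc ((y : ℂ) * Complex.I).im (1 + (y' : ℂ) * Complex.I).im) := by
    refine DifferentiableOn.smul (by fun_prop) (hg.mono ?_)
    intro w hw
    have := hw.2
    simp only [Complex.mul_im, Complex.ofReal_re, Complex.I_im, mul_one, Complex.ofReal_im,
      Complex.I_re, mul_zero, add_zero, Complex.add_im, Complex.one_im, zero_add,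
      Set.mem_preimage, Set.uIcc_of_le hyy', Set.mem_Icc] at this
    exact lt_of_lt_of_le hy this.1
  have := Complex.integral_boundary_rect_eq_zero_of_differentiableOn k _ _ hd
  have hper : ∀ t ∈ Set.uIcc y y', k (((1 : ℝ) : ℂ) + t * Complex.I)
      = k (((0 : ℝ) : ℂ) + t * Complex.I) := by
    intro t ht
    rw [Set.uIcc_of_le hyy'] at ht
    have e : (((1 : ℝ) : ℂ) + t * Complex.I) = (((0 : ℝ) : ℂ) + t * Complex.I) + 1 := by
      push_cast; ring
    simp only [hk]
    rw [e, hp _ (by simpa using lt_of_lt_of_le hy ht.1)]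
    congr 1
    rw [mul_add, neg_add, Complex.exp_add]
    have : Complex.exp (-(2 * Real.pi * Complex.I * p * 1)) = 1 := by
      rw [Complex.exp_eq_one_iff]
      exact ⟨-p, by push_cast; ring⟩
    rw [this, mul_one]
  have hI := intervalIntegral.integral_congr (μ := MeasureTheory.volume) hper
  simp only [Complex.mul_re, Complex.ofReal_re, Complex.I_re, mul_zero, Complex.ofReal_im,
    Complex.I_im, mul_one, sub_self, Complex.add_re, Complex.one_re, add_zero, Complex.mul_im,
    Complex.add_im, Complex.one_im, zero_add, Complex.ofReal_zero] at this hI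
  rw [hI] at this
  simp only [add_sub_cancel_right] at this
  exact sub_eq_zero.1 this

lemma fc_eq {g : ℂ → V} {a : ℝ} (hg : DifferentiableOn ℂ g {w | a < w.im})
    (hp : ∀ w : ℂ, a < w.im → g (w + 1) = g w) (p : ℤ) {y y' : ℝ} (hy : a < y) (hy' : a < y') :
    fc g p y = fc g p y' := by
  rcases le_total y y' with h | h
  · exact fc_eq_of_le hg hp p hy h
  · exact (fc_eq_of_le hg hp p hy' h).symm

lemma fc_clm {g : ℂ → V} [CompleteSpace V] {a : ℝ} (hg : ContinuousOn g {w | a < w.im}) (p : ℤ)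
    {y : ℝ} (hy : a < y) (φ : V →L[ℂ] ℂ) : fc (φ ∘ g) p y = φ (fc g p y) := by
  unfold fc
  rw [← ContinuousLinearMap.intervalIntegral_comp_comm]
  · simp
  · apply Continuous.intervalIntegrable
    refine Continuous.smul (by fun_prop) ?_
    exact hg.comp_continuous (by fun_prop) (fun x => by simpa using hy)

lemma periodic_line {W : Type*} {g : ℂ → W} {a : ℝ} (hp : ∀ w : ℂ, a < w.im → g (w + 1) = g w) {y : ℝ}
    (hy : a < y) : Function.Periodic (fun x : ℝ => g (x + y * Complex.I)) 1 := by
  intro x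
  have := hp (x + y * Complex.I) (by simpa using hy)
  simp only [Complex.ofReal_add, Complex.ofReal_one]
  rw [← this]; congr 1; ring

lemma bounded_line {W : Type*} [NormedAddCommGroup W] {g : ℂ → W} {a : ℝ} (hg : ContinuousOn g {w | a < w.im})
    (hp : ∀ w : ℂ, a < w.im → g (w + 1) = g w) {y : ℝ} (hy : a < y) :
    ∃ C, ∀ x : ℝ, ‖g (x + y * Complex.I)‖ ≤ C := by
  have hc : Continuous (fun x : ℝ => g (x + y * Complex.I)) :=
    hg.comp_continuous (by fun_prop) (fun x => by simpa using hy)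
  obtain ⟨C, hC⟩ := isBounded_iff_forall_norm_le.1
    ((periodic_line hp hy).isBounded_of_continuous one_ne_zero hc)
  exact ⟨C, fun x => hC _ ⟨x, rfl⟩⟩

/-- On the line of height `y` the function descends to the circle, where its `p`-th coefficient is
`fc g p y` times a factor of modulus `exp (-2πpy)`; this is the weight in the summability
hypothesis. -/
lemma hasSum_fc {g : ℂ → ℂ} {a : ℝ} (hg : ContinuousOn g {w | a < w.im})
    (hp : ∀ w : ℂ, a < w.im → g (w + 1) = g w) {y : ℝ} (hy : a < y)
    (hs : Summable fun p : ℤ => ‖fc g p y‖ * Real.exp (-(2 * Real.pi * p * y))) (x : ℝ) :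
    HasSum (fun p : ℤ => fc g p y * Complex.exp (2 * Real.pi * Complex.I * p *
      (x + y * Complex.I))) (g (x + y * Complex.I)) := by
  have : Fact ((0 : ℝ) < 1) := ⟨one_pos⟩
  have hper := periodic_line hp hy
  have hc : Continuous (fun x : ℝ => g (x + y * Complex.I)) :=
    hg.comp_continuous (by fun_prop) (fun x => by simpa using hy)
  let G : C(AddCircle (1 : ℝ), ℂ) := ⟨hper.lift, continuous_coinduced_dom.2 hc⟩
  have hG : ∀ t : ℝ, G (t : AddCircle (1 : ℝ)) = g (t + y * Complex.I) := fun t =>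
    hper.lift_coe t
  have hcoef : ∀ p : ℤ, fourierCoeff G p
      = fc g p y * Complex.exp (2 * Real.pi * Complex.I * p * (y * Complex.I)) := by
    intro p
    rw [fourierCoeff_eq_intervalIntegral _ p 0, fc, ← intervalIntegral.integral_mul_const]
    simp only [div_one, one_smul, zero_add]
    refine intervalIntegral.integral_congr fun t _ => ?_
    simp only [hG, fourier_coe_apply, smul_eq_mul]
    rw [mul_right_comm (Complex.exp (-_)), ← Complex.exp_add]
    congr 2
    push_cast
    ring
  have hsum : Summable (fourierCoeff G) := by
    refine Summable.of_norm (hs.congr fun p => ?_)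
    rw [hcoef, norm_mul, Complex.norm_exp]
    congr 2
    simp
  have := has_pointwise_sum_fourier_series_of_summable hsum (x : AddCircle (1 : ℝ))
  rw [hG] at this
  refine this.congr_fun fun p => ?_
  rw [hcoef, smul_eq_mul, fourier_coe_apply, mul_assoc (fc g p y), ← Complex.exp_add]
  congr 2
  push_cast
  ring

/-- A periodic holomorphic function on the upper half plane without negative Fourier coefficients
converges exponentially fast at `i∞` to its constant term. -/
lemma norm_sub_fc_zero_le [FiniteDimensional ℂ V] {g : ℂ → V}
    (hg : DifferentiableOn ℂ g {w | 0 < w.im})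
    (hp : ∀ w : ℂ, 0 < w.im → g (w + 1) = g w) (hneg : ∀ p : ℤ, p < 0 → fc g p 1 = 0) :
    ∃ D, 0 ≤ D ∧ ∀ w : ℂ, 1 ≤ w.im → ‖g w - fc g 0 1‖ ≤ D * Real.exp (-(2 * Real.pi * w.im)) := by
  have : CompleteSpace V := FiniteDimensional.complete ℂ V
  -- Coefficients are estimated at height `1/2`, strictly below the region `Im w ≥ 1`; the gap makes
  -- the terms geometrically summable with the factor `exp (-2π Im w)` pulled out.
  have hh : (0 : ℝ) < 1 / 2 := by norm_num
  obtain ⟨C, hC⟩ := bounded_line hg.continuousOn hp hh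
  have hC0 : 0 ≤ C := (norm_nonneg _).trans (hC 0)
  have hS : Summable fun k : ℕ => Real.exp (-(k * Real.pi)) := by
    have h2 := Real.summable_exp_nat_mul_iff.2 (neg_lt_zero.2 Real.pi_pos)
    simpa [mul_neg] using h2
  set S := ∑' k : ℕ, Real.exp (-(k * Real.pi))
  have hS0 : 0 ≤ S := tsum_nonneg fun k => (Real.exp_pos _).le
  have hbound : ∀ (k : ℕ) (y : ℝ), 1 ≤ y →
      ‖fc g ((k : ℤ) + 1) y‖ * Real.exp (-(2 * Real.pi * ((k : ℤ) + 1 : ℤ) * y))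
        ≤ C * Real.exp Real.pi * Real.exp (-(2 * Real.pi * y)) * Real.exp (-(k * Real.pi)) := by
    intro k y hy
    rw [fc_eq hg hp _ (by linarith : (0 : ℝ) < y) hh]
    have h1 := norm_fc_le g ((k : ℤ) + 1) (1 / 2) C hC
    refine (mul_le_mul_of_nonneg_right h1 (Real.exp_pos _).le).trans ?_
    rw [mul_right_comm, ← Real.exp_add, mul_comm _ C, mul_assoc C, mul_assoc C, ← Real.exp_add,
      ← Real.exp_add]
    refine mul_le_mul_of_nonneg_left (Real.exp_le_exp.2 ?_) hC0
    push_cast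
    have : 0 ≤ (k : ℝ) * Real.pi * (y - 1) :=
      mul_nonneg (mul_nonneg k.cast_nonneg Real.pi_pos.le) (by linarith)
    nlinarith [Real.pi_pos]
  refine ⟨C * Real.exp Real.pi * S, by positivity, fun w hw => ?_⟩
  have hw0 : 0 < w.im := by linarith
  have hpos : 0 ≤ C * Real.exp Real.pi * S * Real.exp (-(2 * Real.pi * w.im)) := by positivity
  -- The Fourier series is summed for scalar functions only, so the estimate is tested against
  -- continuous functionals.
  refine NormedSpace.norm_le_dual_bound ℂ _ hpos fun φ => ?_
  have hgφ : ContinuousOn (φ ∘ g) {w | 0 < w.im} :=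
    φ.continuous.comp_continuousOn hg.continuousOn
  have hpφ : ∀ w : ℂ, 0 < w.im → (φ ∘ g) (w + 1) = (φ ∘ g) w := fun w hw => by
    simp [hp w hw]
  have hcφ : ∀ p, fc (φ ∘ g) p w.im = φ (fc g p w.im) := fun p => fc_clm hg.continuousOn p hw0 φ
  have hz : ∀ k : ℕ, fc g (Int.negSucc k) w.im = 0 := fun k => by
    rw [fc_eq hg hp _ hw0 one_pos]; exact hneg _ (Int.negSucc_lt_zero k)
  have hbφ : ∀ k : ℕ, ‖φ (fc g ((k : ℤ) + 1) w.im)‖ *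
      Real.exp (-(2 * Real.pi * ((k : ℤ) + 1 : ℤ) * w.im)) ≤
      ‖φ‖ * (C * Real.exp Real.pi * Real.exp (-(2 * Real.pi * w.im))) *
        Real.exp (-(k * Real.pi)) := by
    intro k
    refine (mul_le_mul_of_nonneg_right (φ.le_opNorm _) (Real.exp_pos _).le).trans ?_
    rw [mul_assoc, mul_assoc ‖φ‖]
    exact mul_le_mul_of_nonneg_left (hbound k _ hw) (norm_nonneg _)
  have hS' := hS.mul_left (‖φ‖ * (C * Real.exp Real.pi * Real.exp (-(2 * Real.pi * w.im))))
  have hsum : Summable fun p : ℤ => ‖fc (φ ∘ g) p w.im‖ *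
      Real.exp (-(2 * Real.pi * p * w.im)) := by
    refine Summable.of_nat_of_neg_add_one ?_ ?_
    · rw [← summable_nat_add_iff 1]
      refine Summable.of_nonneg_of_le (fun k => by positivity) (fun k => ?_) hS'
      rw [hcφ]
      exact_mod_cast hbφ k
    · refine summable_zero.congr fun k => ?_
      have := hz k
      rw [Int.negSucc_eq] at this
      rw [hcφ, this]
      simp
  have hs := hasSum_fc hgφ hpφ hw0 hsum w.re
  rw [Complex.re_add_im] at hs
  have h0 : fc (φ ∘ g) 0 w.im = φ (fc g 0 1) := by rw [hcφ, fc_eq hg hp _ hw0 one_pos]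
  set F : ℤ → ℂ := fun p => fc (φ ∘ g) p w.im * Complex.exp (2 * Real.pi * Complex.I * p * w)
    with hF
  have hF0 : F 0 = φ (fc g 0 1) := by simp [hF, h0]
  have hn : ∀ k : ℕ, ‖F ((k : ℤ) + 1)‖ ≤
      ‖φ‖ * (C * Real.exp Real.pi * Real.exp (-(2 * Real.pi * w.im))) *
        Real.exp (-(k * Real.pi)) := by
    intro k
    refine le_trans (le_of_eq ?_) (hbφ k)
    rw [hF, norm_mul, hcφ, Complex.norm_exp]
    congr 2
    simp
  have hval : φ (g w - fc g 0 1) = ∑' k : ℕ, F ((k : ℤ) + 1) := by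
    have hz' : ∀ k : ℕ, F (-((k : ℤ) + 1)) = 0 := fun k => by
      have := hz k
      rw [Int.negSucc_eq] at this
      change fc (φ ∘ g) _ w.im * _ = 0
      rw [hcφ, this, map_zero, zero_mul]
    have h1 := tsum_of_add_one_of_neg_add_one (f := F) (hS'.of_norm_bounded hn)
      (summable_zero.congr fun k => (hz' k).symm)
    rw [hs.tsum_eq, hF0] at h1
    simp only [hz', tsum_zero, add_zero] at h1
    rw [map_sub, sub_eq_iff_eq_add]
    exact h1
  rw [hval]
  refine (tsum_of_norm_bounded hS'.hasSum hn).trans (le_of_eq ?_)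
  rw [tsum_mul_left]
  ring

/-- The coefficient does not depend on the height `y`, while its bound `exp (2πpy) C` vanishes as `y
→ ∞`. -/
lemma fc_eq_zero_of_bounded {g : ℂ → V} (hg : DifferentiableOn ℂ g {w | 0 < w.im})
    (hp : ∀ w : ℂ, 0 < w.im → g (w + 1) = g w) {C : ℝ} (hC : ∀ w : ℂ, 1 ≤ w.im → ‖g w‖ ≤ C)
    {p : ℤ} (hneg : p < 0) : fc g p 1 = 0 := by
  have hb : ∀ᶠ y : ℝ in atTop, ‖fc g p 1‖ ≤ Real.exp (2 * Real.pi * p * y) * C := by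
    filter_upwards [eventually_ge_atTop 1] with y hy
    rw [fc_eq hg hp p one_pos (by linarith : (0 : ℝ) < y)]
    exact norm_fc_le g p y C fun x => hC _ (by simpa using hy)
  have hp' : (p : ℝ) < 0 := by exact_mod_cast hneg
  have ht : Tendsto (fun y : ℝ => Real.exp (2 * Real.pi * p * y) * C) atTop (𝓝 (0 * C)) :=
    (Real.tendsto_exp_atBot.comp (tendsto_id.const_mul_atTop_of_neg
      (mul_neg_of_pos_of_neg Real.two_pi_pos hp'))).mul_const C
  rw [zero_mul] at ht
  exact norm_le_zero_iff.1 (ge_of_tendsto ht hb)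

/-- The maximum principle on the upper half plane for bounded functions. -/
lemma norm_le_of_bounded_of_real [FiniteDimensional ℂ V] {g : ℂ → V}
    (hd : ∀ w : ℂ, 0 ≤ w.im → DifferentiableAt ℂ g w) {B C : ℝ}
    (hB : ∀ w : ℂ, 0 ≤ w.im → ‖g w‖ ≤ B) (hC : ∀ x : ℝ, ‖g x‖ ≤ C) {w : ℂ} (hw : 0 ≤ w.im) :
    ‖g w‖ ≤ C := by
  -- Rotation to the right half plane, where Phragmén–Lindelöf is applied.
  set k : ℂ → V := fun z => g (Complex.I * z)
  have hk : ∀ z : ℂ, 0 ≤ z.re → DifferentiableAt ℂ k z := fun z hz =>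
    (hd (Complex.I * z) (by simpa using hz)).comp z (by fun_prop)
  have hkB : ∀ z : ℂ, 0 ≤ z.re → ‖k z‖ ≤ B := fun z hz => hB _ (by simpa using hz)
  have := PhragmenLindelof.right_half_plane_of_bounded_on_real (f := k) (C := C)
    (z := -Complex.I * w) ?_ ⟨1, by norm_num, 0, ?_⟩ ?_ ?_ (by simpa using hw)
  · simpa [k, ← mul_assoc] using this
  · refine ⟨fun z hz => (hk z (le_of_lt hz)).differentiableWithinAt, fun z hz => ?_⟩
    rw [Complex.closure_setOfPred_lt_re] at hz
    exact (hk z hz).continuousAt.continuousWithinAt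
  · simp only [zero_mul, Real.exp_zero]
    refine Asymptotics.IsBigO.of_bound B ?_
    refine Filter.eventually_inf_principal.2 (Eventually.of_forall fun z hz => ?_)
    simpa using hkB z (le_of_lt hz)
  · refine ⟨B, ?_⟩
    simp only [eventually_map]
    filter_upwards [eventually_ge_atTop 0] with x hx
    exact hkB x (by simpa using hx)
  · intro x
    have e : Complex.I * (x * Complex.I) = ((-x : ℝ) : ℂ) := by
      push_cast; linear_combination (x : ℂ) * Complex.I_mul_I
    simp only [k]
    rw [e]
    exact hC _

end FourierCoefficients

/-! ### Holomorphic dependence of integrals on parameters. -/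

section ParametricIntegrals

variable {V : Type*} [NormedAddCommGroup V] [NormedSpace ℂ V]
variable {E : Type*} [NormedAddCommGroup E] [NormedSpace ℂ E]

/-- Cauchy's estimate for the Fréchet derivative. -/
lemma norm_fderiv_le_of_bounded_ball {f : E → V} {z : E} {r C : ℝ} (hr : 0 < r)
    (hf : DifferentiableOn ℂ f (Metric.ball z r)) (hC : ∀ w ∈ Metric.ball z r, ‖f w‖ ≤ C) :
    ‖fderiv ℂ f z‖ ≤ C / (r / 2) := by
  have hC0 : 0 ≤ C := (norm_nonneg _).trans (hC z (Metric.mem_ball_self hr))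
  -- Restriction to the complex line through `z` in direction `v`; radius `r / 2` keeps the closed
  -- disc inside the ball.
  refine ContinuousLinearMap.opNorm_le_of_unit_norm (by positivity) fun v hv => ?_
  have hmem : ∀ t ∈ Metric.closedBall (0 : ℂ) (r / 2), z + t • v ∈ Metric.ball z r := by
    intro t ht
    rw [mem_closedBall_zero_iff] at ht
    rw [mem_ball_iff_norm, add_sub_cancel_left, norm_smul, hv, mul_one]
    linarith
  have hdz : DifferentiableAt ℂ f z := (hf z (Metric.mem_ball_self hr)).differentiableAt
    (Metric.ball_mem_nhds z hr)
  have hline : ∀ t, HasDerivAt (fun t : ℂ => z + t • v) v t := fun t => by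
    simpa using ((hasDerivAt_id t).smul_const v).const_add z
  have hder : deriv (fun t : ℂ => f (z + t • v)) 0 = fderiv ℂ f z v := by
    have h1 : HasFDerivAt f (fderiv ℂ f z) (z + (0 : ℂ) • v) := by
      simpa using hdz.hasFDerivAt
    exact (h1.comp_hasDerivAt (0 : ℂ) (hline 0)).deriv
  rw [← hder]
  refine Complex.norm_deriv_le_of_forall_mem_sphere_norm_le (by positivity) ?_ fun t ht => ?_
  · refine DifferentiableOn.diffContOnCl ?_
    rw [closure_ball _ (by positivity)]
    exact hf.comp (fun t _ => (hline t).differentiableAt.differentiableWithinAt) hmem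
  · exact hC _ (hmem t (Metric.sphere_subset_closedBall ht))

/-- Differentiation under the integral sign over `[0, 1]` for holomorphic integrands. -/
lemma differentiableAt_integral_of_holomorphic {H : Type*} [NormedAddCommGroup H]
    [NormedSpace ℂ H] [FiniteDimensional ℂ E] [FiniteDimensional ℂ V] {f : E → V} {U : Set E}
    (hU : IsOpen U) (hf : DifferentiableOn ℂ f U) (A : H →L[ℂ] E) {γ : ℝ → E} (hγ : Continuous γ)
    {θ : ℝ → ℂ} (hθ : Continuous θ) (h₀ : H)
    (hmem : ∀ x ∈ Set.Icc (0 : ℝ) 1, A h₀ + γ x ∈ U) :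
    DifferentiableAt ℂ (fun h => ∫ x in (0 : ℝ)..1, θ x • f (A h + γ x)) h₀ := by
  have : CompleteSpace V := FiniteDimensional.complete ℂ V
  have : ProperSpace E := FiniteDimensional.proper ℂ E
  set K : Set E := (fun x => A h₀ + γ x) '' Set.Icc (0 : ℝ) 1 with hK
  have hKc : IsCompact K := isCompact_Icc.image (by fun_prop)
  have hKU : K ⊆ U := by rintro _ ⟨x, hx, rfl⟩; exact hmem x hx
  -- Half of `δ` is spent on moving the parameter and half on the ball for Cauchy's estimate, so the
  -- derivatives have a uniform bound.
  obtain ⟨δ, hδ, hδU⟩ := hKc.exists_cthickening_subset_open hU hKU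
  have hKδ : IsCompact (Metric.cthickening δ K) := hKc.cthickening
  obtain ⟨C, hC⟩ := hKδ.exists_bound_of_continuousOn (hf.continuousOn.mono hδU)
  obtain ⟨D, hD⟩ := (isCompact_Icc (a := (0 : ℝ)) (b := 1)).exists_bound_of_continuousOn
    hθ.continuousOn
  have hnear : ∀ᶠ h in 𝓝 h₀, ‖A h - A h₀‖ < δ / 2 := by
    have : Tendsto (fun h => ‖A h - A h₀‖) (𝓝 h₀) (𝓝 0) := by
      have h1 : Continuous fun h => ‖A h - A h₀‖ := by fun_prop
      simpa using h1.tendsto h₀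
    exact this.eventually_lt_const (by positivity)
  have hball : ∀ h, ‖A h - A h₀‖ < δ / 2 → ∀ x ∈ Set.Icc (0 : ℝ) 1,
      Metric.ball (A h + γ x) (δ / 2) ⊆ Metric.cthickening δ K := by
    intro h hh x hx w hw
    refine Metric.mem_cthickening_of_dist_le w (A h₀ + γ x) δ K ⟨x, hx, rfl⟩ ?_
    rw [mem_ball_iff_norm] at hw
    rw [dist_eq_norm]
    calc ‖w - (A h₀ + γ x)‖ = ‖(w - (A h + γ x)) + (A h - A h₀)‖ := by congr 1; abel
      _ ≤ ‖w - (A h + γ x)‖ + ‖A h - A h₀‖ := norm_add_le _ _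
      _ ≤ δ := by linarith
  have hmem' : ∀ h, ‖A h - A h₀‖ < δ / 2 → ∀ x ∈ Set.Icc (0 : ℝ) 1, A h + γ x ∈ U :=
    fun h hh x hx => hδU (hball h hh x hx (Metric.mem_ball_self (by positivity)))
  have hcont : ∀ h, ‖A h - A h₀‖ < δ / 2 →
      ContinuousOn (fun x => θ x • f (A h + γ x)) (Set.Icc 0 1) := fun h hh =>
    hθ.continuousOn.smul (hf.continuousOn.comp (by fun_prop) (hmem' h hh))
  have hI : Set.uIoc (0 : ℝ) 1 ⊆ Set.Icc 0 1 := by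
    rw [Set.uIoc_of_le zero_le_one]; exact Set.Ioc_subset_Icc_self
  borelize E
  borelize (E →L[ℂ] V)
  refine (intervalIntegral.hasFDerivAt_integral_of_dominated_of_fderiv_le (𝕜 := ℂ)
    (F := fun h x => θ x • f (A h + γ x))
    (F' := fun h x => θ x • (fderiv ℂ f (A h + γ x)).comp A)
    (bound := fun _ => D * (C / (δ / 2 / 2) * ‖A‖)) hnear ?_ ?_ ?_ ?_ ?_ ?_).differentiableAt
  · filter_upwards [hnear] with h hh
    exact ((hcont h hh).mono hI).aestronglyMeasurable measurableSet_uIoc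
  · refine ContinuousOn.intervalIntegrable ?_
    rw [Set.uIcc_of_le zero_le_one]
    exact hcont h₀ (by simpa using half_pos hδ)
  · refine hθ.aestronglyMeasurable.smul ?_
    have : ProperSpace (E →L[ℂ] V) := FiniteDimensional.proper ℂ _
    have h1 : Measurable fun x => fderiv ℂ f (A h₀ + γ x) :=
      (measurable_fderiv ℂ f).comp (by fun_prop : Continuous fun x => A h₀ + γ x).measurable
    exact ((ContinuousLinearMap.compL ℂ H E V).flip A).continuous.comp_aestronglyMeasurable
      h1.aestronglyMeasurable
  · refine Eventually.of_forall fun x hx h hh => ?_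
    rw [norm_smul]
    have h1 := norm_fderiv_le_of_bounded_ball (half_pos hδ)
      (hf.mono ((hball h hh x (hI hx)).trans hδU)) (fun w hw => hC w (hball h hh x (hI hx) hw))
    refine mul_le_mul (hD x (hI hx)) ((ContinuousLinearMap.opNorm_comp_le _ _).trans
      (mul_le_mul_of_nonneg_right h1 (norm_nonneg _))) (norm_nonneg _)
      ((norm_nonneg _).trans (hD x (hI hx)))
  · exact intervalIntegrable_const
  · refine Eventually.of_forall fun x hx h hh => ?_
    have h1 : DifferentiableAt ℂ f (A h + γ x) := (hf _ (hmem' h hh x (hI hx))).differentiableAt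
      (hU.mem_nhds (hmem' h hh x (hI hx)))
    exact (h1.hasFDerivAt.comp h (A.hasFDerivAt.add_const (γ x))).const_smul (θ x)

end ParametricIntegrals

/-! ### Openness of the Siegel half plane and conjugation by transvections. -/

section SiegelSpace

variable {n : ℕ}

lemma posDef_of_forall_pos {Y : Matrix (Fin n) (Fin n) ℝ} (hs : Y.IsSymm)
    (h : ∀ x ∈ Metric.sphere (0 : Fin n → ℝ) 1, 0 < x ⬝ᵥ Y *ᵥ x) : Y.PosDef := by
  refine PosDef.of_dotProduct_mulVec_pos ?_ fun x hx => ?_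
  · rw [IsHermitian, conjTranspose_eq_transpose_of_trivial]; exact hs
  · have hn : 0 < ‖x‖ := norm_pos_iff.2 hx
    have := h (‖x‖⁻¹ • x) (by simp [norm_smul, hn.ne'])
    rw [mulVec_smul, dotProduct_smul, smul_dotProduct, smul_eq_mul, smul_eq_mul] at this
    simp only [star_trivial]
    have h2 : 0 < ‖x‖⁻¹ := inv_pos.2 hn
    exact pos_of_mul_pos_right (pos_of_mul_pos_right this h2.le) h2.le

/-- By homogeneity positivity need only be tested on the unit sphere, whose compactness makes it an
open condition. -/
lemma isOpen_siegelH : IsOpen {Z : SymMat n | (Z : Matrix (Fin n) (Fin n) ℂ) ∈ SiegelH n} := by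
  rw [isOpen_iff_eventually]
  intro Z₀ hZ₀
  have hS : IsCompact (Metric.sphere (0 : Fin n → ℝ) 1) := isCompact_sphere _ _
  have key : ∀ᶠ Z : SymMat n in 𝓝 Z₀, ∀ x ∈ Metric.sphere (0 : Fin n → ℝ) 1,
      0 < x ⬝ᵥ ((Z : Matrix (Fin n) (Fin n) ℂ).map Complex.im) *ᵥ x := by
    refine hS.eventually_forall_of_forall_eventually fun x hx => ?_
    have hc : Continuous fun q : SymMat n × (Fin n → ℝ) =>
        q.2 ⬝ᵥ ((q.1 : Matrix (Fin n) (Fin n) ℂ).map Complex.im) *ᵥ q.2 := by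
      refine Continuous.dotProduct continuous_snd (Continuous.matrix_mulVec ?_ continuous_snd)
      exact (continuous_subtype_val.comp continuous_fst).matrix_map Complex.continuous_im
    refine (isOpen_lt continuous_const hc).mem_nhds ?_
    have hx0 : x ≠ 0 := by
      rintro rfl
      simp at hx
    simpa using hZ₀.2.dotProduct_mulVec_pos hx0
  filter_upwards [key] with Z hZ
  exact ⟨Z.2, posDef_of_forall_pos (Z.2.map Complex.im) hZ⟩

lemma map_im_mul_mul (A B : Matrix (Fin n) (Fin n) ℝ) (Z : Matrix (Fin n) (Fin n) ℂ) :
    (A.map Complex.ofReal * Z * B.map Complex.ofReal).map Complex.im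
      = A * Z.map Complex.im * B := by
  ext i j
  simp [Matrix.mul_apply]

lemma map_im_add_smul (A : Matrix (Fin n) (Fin n) ℂ) (w : ℂ) (M : Matrix (Fin n) (Fin n) ℝ) :
    (A + w • M.map Complex.ofReal).map Complex.im = A.map Complex.im + w.im • M := by
  ext i j
  simp

/-- The orbit of `Y` under the transvections is a parabola whose quadratic part lies along `E_jj`.
Thus a shift in the linear direction, corrected by a multiple of `E_jj`, amounts to a conjugation.
-/
lemma transvection_mul_mul_transpose {R : Type*} [CommRing R] (j l : Fin n)
    (Y : Matrix (Fin n) (Fin n) R) (b : R) :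
    transvection j l b * Y * (transvection j l b)ᵀ =
      Y + b • (single j l 1 * Y + Y * single l j 1) + (b ^ 2 * Y l l) • single j j 1 := by
  have e : single j l b = b • single j l (1 : R) := by simp
  have e' : single j l (1 : R) * Y * single l j (1 : R) = Y l l • single j j (1 : R) := by
    rw [single_mul_mul_single]
    simp
  rw [transvection, transpose_add, transpose_one, transpose_single, e,
    show single l j b = b • single l j (1 : R) by simp]
  simp only [add_mul, mul_add, one_mul, mul_one, smul_mul_assoc, mul_smul_comm, e', smul_smul,
    smul_add]
  rw [pow_two, mul_assoc b b]
  abel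

lemma transvection_mul_single_mul_transpose {R : Type*} [CommRing R] {j l : Fin n} (h : j ≠ l)
    (b : R) : transvection j l b * single j j 1 * (transvection j l b)ᵀ = single j j 1 := by
  rw [transvection, transpose_add, transpose_one, transpose_single]
  simp [add_mul, mul_add, h, h.symm]

/-- Transvections are additive in `b`, so an integral one moves the parameter into `[0, 1)`. -/
lemma transvection_fract_conj {j l : Fin n} (h : j ≠ l) (Y : Matrix (Fin n) (Fin n) ℝ) (b : ℝ) :
    transvection j l (Int.fract b) * Y * (transvection j l (Int.fract b))ᵀ =
      transvection j l ((-⌊b⌋ : ℤ) : ℝ) * (transvection j l b * Y * (transvection j l b)ᵀ) *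
        (transvection j l ((-⌊b⌋ : ℤ) : ℝ))ᵀ := by
  have e : Int.fract b = ((-⌊b⌋ : ℤ) : ℝ) + b := by rw [Int.fract]; push_cast; ring
  rw [e, ← transvection_mul_transvection_same _ _ h, transpose_mul]
  simp only [Matrix.mul_assoc]

lemma posDef_conj_transvection {j l : Fin n} (h : j ≠ l) {Y : Matrix (Fin n) (Fin n) ℝ}
    (hY : Y.PosDef) (b : ℝ) : (transvection j l b * Y * (transvection j l b)ᵀ).PosDef := by
  have := hY.mul_mul_conjTranspose_same (B := transvection j l b) ?_
  · rwa [conjTranspose_eq_transpose_of_trivial] at this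
  · apply vecMul_injective_of_isUnit
    rw [isUnit_iff_isUnit_det, det_transvection_of_ne _ _ h]
    exact isUnit_one

lemma posSemidef_single (j : Fin n) : (single j j (1 : ℝ)).PosSemidef := by
  rw [← diagonal_single]
  exact PosSemidef.diagonal fun i => by
    by_cases h : i = j
    · subst h; simp
    · simp [h]

end SiegelSpace

/-! ### Koecher's principle for one diagonal variable. -/

section FourierJacobi

attribute [local instance] Matrix.normedAddCommGroup Matrix.normedSpace

variable {V : Type*} [NormedAddCommGroup V] [NormedSpace ℂ V]
variable {n : ℕ} {F : Matrix (Fin n) (Fin n) ℂ → V}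

lemma differentiableAt_line
    (hF : DifferentiableOn ℂ (fun Z : SymMat n => F Z) {Z : SymMat n | Z.1 ∈ SiegelH n})
    {A B : Matrix (Fin n) (Fin n) ℂ} (hA : A.IsSymm) (hB : B.IsSymm) {w : ℂ}
    (hw : A + w • B ∈ SiegelH n) : DifferentiableAt ℂ (fun w : ℂ => F (A + w • B)) w := by
  have h1 : DifferentiableAt ℂ (fun Z : SymMat n => F Z) ((⟨A, hA⟩ : SymMat n) + w • ⟨B, hB⟩) :=
    hF.differentiableAt (isOpen_siegelH.mem_nhds hw)
  have h2 : DifferentiableAt ℂ (fun w : ℂ => (⟨A, hA⟩ : SymMat n) + w • ⟨B, hB⟩) w := by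
    fun_prop
  exact DifferentiableAt.comp (g := fun Z : SymMat n => F Z) w h1 h2

/-- A function with all integral symmetric periods is bounded where `Im Z` is in a compact set. -/
lemma exists_bound_of_isCompact_im
    (hF : DifferentiableOn ℂ (fun Z : SymMat n => F Z) {Z : SymMat n | Z.1 ∈ SiegelH n})
    (hT : ∀ S : Matrix (Fin n) (Fin n) ℤ, S.IsSymm → ∀ Z ∈ SiegelH n,
      F (Z + S.map (Int.cast : ℤ → ℂ)) = F Z)
    {K : Set (Matrix (Fin n) (Fin n) ℝ)} (hK : IsCompact K) (hpos : ∀ Y ∈ K, Y.PosDef) :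
    ∃ C, ∀ Z ∈ SiegelH n, Z.map Complex.im ∈ K → ‖F Z‖ ≤ C := by
  have : ProperSpace (SymMat n) := FiniteDimensional.proper ℂ _
  -- A compact set that meets every orbit of the integral translations with `Im Z ∈ K`.
  set T : Set (SymMat n) := {Z | (∀ i j, (Z.1 i j).re ∈ Set.Icc (0 : ℝ) 1) ∧
    Z.1.map Complex.im ∈ K}
  have hTc : IsCompact T := by
    refine Metric.isCompact_of_isClosed_isBounded ?_ ?_
    · refine IsClosed.inter (s₁ := {Z : SymMat n | ∀ i j, (Z.1 i j).re ∈ Set.Icc (0 : ℝ) 1}) ?_ ?_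
      · simp only [Set.ofPred_forall]
        refine isClosed_iInter fun i => isClosed_iInter fun j => isClosed_Icc.preimage ?_
        exact Complex.continuous_re.comp (continuous_subtype_val.matrix_elem i j)
      · exact hK.isClosed.preimage (continuous_subtype_val.matrix_map Complex.continuous_im)
    · obtain ⟨D, hD⟩ := isBounded_iff_forall_norm_le.1 hK.isBounded
      refine isBounded_iff_forall_norm_le.2 ⟨1 + D, fun Z hZ => ?_⟩
      have hD0 : 0 ≤ D := (norm_nonneg _).trans (hD _ hZ.2)
      refine (Matrix.norm_le_iff (by positivity)).2 fun i j => ?_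
      refine (Complex.norm_le_abs_re_add_abs_im _).trans (add_le_add ?_ ?_)
      · exact (abs_of_nonneg (hZ.1 i j).1).trans_le (hZ.1 i j).2
      · exact (Matrix.norm_entry_le_entrywise_sup_norm (Z.1.map Complex.im) (i := i) (j := j)).trans
          (hD _ hZ.2)
  have hTH : T ⊆ {Z : SymMat n | Z.1 ∈ SiegelH n} := fun Z hZ => ⟨Z.2, hpos _ hZ.2⟩
  obtain ⟨C, hC⟩ := hTc.exists_bound_of_continuousOn (hF.continuousOn.mono hTH)
  refine ⟨C, fun Z hZ hZK => ?_⟩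
  set S : Matrix (Fin n) (Fin n) ℤ := Matrix.of fun i j => -⌊(Z i j).re⌋
  have hS : S.IsSymm := by
    ext i j
    simp [S, hZ.1.apply i j]
  have hsym : (Z + S.map (Int.cast : ℤ → ℂ)).IsSymm := hZ.1.add (hS.map _)
  rw [← hT S hS Z hZ]
  refine hC ⟨_, hsym⟩ ⟨fun i j => ?_, ?_⟩
  · have h1 := Int.floor_le (Z i j).re
    have h2 := Int.lt_floor_add_one (Z i j).re
    simp only [Matrix.add_apply, map_apply, S, of_apply, Int.cast_neg, Complex.add_re, Complex.neg_re,
      Complex.intCast_re, Set.mem_Icc]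
    constructor <;> linarith
  · convert hZK using 1
    ext i j
    simp

/-- A Gaussian beats every exponential, with `exp (-|b|)` to spare for the passage to the limit. -/
lemma exp_bound_of_quadratic {c B : ℝ} (hc : 0 < c) (hB : 1 ≤ B) :
    ∃ D, 0 ≤ D ∧ ∀ b : ℝ,
      Real.exp (-(c * b ^ 2)) * B ^ ⌊b⌋.natAbs ≤ D * Real.exp (-|b|) := by
  set β := Real.log B
  have hβ : 0 ≤ β := Real.log_nonneg hB
  -- The term `(β + 1) ^ 2 / (4 * c)` is the maximum of `(β + 1) x - c x ^ 2`; the other `β` pays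
  -- for rounding `b` to its floor.
  refine ⟨Real.exp (β + (β + 1) ^ 2 / (4 * c)), (Real.exp_pos _).le, fun b => ?_⟩
  have h1 : B ^ ⌊b⌋.natAbs = Real.exp (⌊b⌋.natAbs * β) := by
    rw [Real.exp_nat_mul, Real.exp_log (by linarith)]
  have h2 : (⌊b⌋.natAbs : ℝ) ≤ |b| + 1 := by
    rw [Nat.cast_natAbs, Int.cast_abs]
    have h3 := Int.floor_le b
    have h4 := Int.lt_floor_add_one b
    refine abs_le.2 ⟨?_, ?_⟩
    · linarith [neg_abs_le b]
    · linarith [le_abs_self b]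
  rw [h1, ← Real.exp_add, ← Real.exp_add]
  refine Real.exp_le_exp.2 ?_
  have h5 : (⌊b⌋.natAbs : ℝ) * β ≤ (|b| + 1) * β := mul_le_mul_of_nonneg_right h2 hβ
  have h6 : 0 ≤ (2 * c * |b| - (β + 1)) ^ 2 / (4 * c) := by positivity
  have h7 : (2 * c * |b| - (β + 1)) ^ 2 / (4 * c)
      = c * b ^ 2 - (β + 1) * |b| + (β + 1) ^ 2 / (4 * c) := by
    rw [← sq_abs b]
    field_simp
    ring
  linarith

set_option maxHeartbeats 400000 in
/-- **Koecher's principle** for the Fourier-Jacobi expansion in a diagonal entry. -/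
lemma fc_single_eq_zero [FiniteDimensional ℂ V]
    (hF : DifferentiableOn ℂ (fun Z : SymMat n => F Z) {Z : SymMat n | Z.1 ∈ SiegelH n})
    (hT : ∀ S : Matrix (Fin n) (Fin n) ℤ, S.IsSymm → ∀ Z ∈ SiegelH n,
      F (Z + S.map (Int.cast : ℤ → ℂ)) = F Z)
    {j l : Fin n} (hjl : j ≠ l) {B : ℝ} (hB : 1 ≤ B)
    (hU : ∀ s : ℤ, ∀ Z ∈ SiegelH n, ‖F Z‖ ≤ B ^ s.natAbs *
      ‖F ((transvection j l (s : ℝ)).map Complex.ofReal * Z *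
        ((transvection j l (s : ℝ))ᵀ).map Complex.ofReal)‖)
    {Z : Matrix (Fin n) (Fin n) ℂ} (hZ : Z ∈ SiegelH n) {p : ℤ} (hp : p < 0) :
    fc (fun w => F (Z + w • single j j 1)) p 1 = 0 := by
  set Y := Z.map Complex.im with hYdef
  have hY : Y.PosDef := hZ.2
  have hYs : Y.IsSymm := hZ.1.map _
  set η := Y l l
  have hη : 0 < η := hY.diag_pos
  set M : Matrix (Fin n) (Fin n) ℝ := single j l 1 * Y + Y * single l j 1 with hM
  have hMs : M.IsSymm := by
    rw [IsSymm, hM, transpose_add, transpose_mul, transpose_mul, hYs.eq, transpose_single,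
      transpose_single, add_comm]
  set E : Matrix (Fin n) (Fin n) ℝ := single j j 1 with hE
  have hEs : E.IsSymm := by rw [IsSymm, hE, transpose_single]
  have hEc : E.map Complex.ofReal = single j j (1 : ℂ) := by
    ext a b; simp only [hE, map_apply, single_apply]; split_ifs <;> simp
  set MC := M.map Complex.ofReal
  have hMCs : MC.IsSymm := hMs.map _
  have hECs : (single j j (1 : ℂ) : Matrix (Fin n) (Fin n) ℂ).IsSymm := by
    rw [← hEc]; exact hEs.map _
  have him : ∀ ζ w : ℂ, (Z + ζ • MC + w • single j j 1).map Complex.im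
      = transvection j l ζ.im * Y * (transvection j l ζ.im)ᵀ + (w.im - ζ.im ^ 2 * η) • E := by
    intro ζ w
    rw [← hEc, map_im_add_smul, map_im_add_smul, transvection_mul_mul_transpose, sub_smul]
    abel
  have hmem : ∀ ζ w : ℂ, ζ.im ^ 2 * η < w.im → Z + ζ • MC + w • single j j 1 ∈ SiegelH n := by
    intro ζ w hw
    refine ⟨(hZ.1.add (hMCs.smul ζ)).add (hECs.smul w), ?_⟩
    rw [him]
    exact (posDef_conj_transvection hjl hY _).add_posSemidef
      ((posSemidef_single j).smul (by linarith))
  set G : ℂ → ℂ → V := fun ζ w => F (Z + ζ • MC + w • single j j 1) with hG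
  have hGd : ∀ ζ, DifferentiableOn ℂ (G ζ) {w | ζ.im ^ 2 * η < w.im} := fun ζ w hw =>
    (differentiableAt_line hF (hZ.1.add (hMCs.smul ζ)) hECs
      (hmem ζ w hw)).differentiableWithinAt
  have hGp : ∀ ζ w : ℂ, ζ.im ^ 2 * η < w.im → G ζ (w + 1) = G ζ w := by
    intro ζ w hw
    have := hT (single j j 1) (by rw [IsSymm, transpose_single]) _ (hmem ζ w hw)
    simp only [hG]
    rw [← this, add_smul, one_smul, ← add_assoc]
    congr 2
    ext a b
    simp [single_apply]
  set ψ : ℂ → V := fun ζ => fc (G ζ) p ((ζ.im ^ 2 + 1) * η) with hψ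
  have hψeq : ∀ (ζ : ℂ) (y : ℝ), ζ.im ^ 2 * η < y → ψ ζ = fc (G ζ) p y := fun ζ y hy =>
    fc_eq (hGd ζ) (hGp ζ) p (by nlinarith) hy
  have hψd : Differentiable ℂ ψ := by
    intro ζ₀
    -- The height in the definition of `ψ` varies with `ζ` non-holomorphically. Since the
    -- coefficient is independent of height, one height admissible on the whole unit disc around
    -- `ζ₀` may replace it.
    set y := ((|ζ₀.im| + 1) ^ 2 + 1) * η with hy
    have hnear : ∀ ζ : ℂ, ‖ζ - ζ₀‖ < 1 → ζ.im ^ 2 * η < y := by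
      intro ζ hζ
      have h1 : |ζ.im| ≤ |ζ₀.im| + 1 := by
        have h2 := (Complex.abs_im_le_norm (ζ - ζ₀)).trans hζ.le
        rw [Complex.sub_im] at h2
        linarith [abs_sub_abs_le_abs_sub ζ.im ζ₀.im]
      have h3 : ζ.im ^ 2 ≤ (|ζ₀.im| + 1) ^ 2 := by
        rw [← sq_abs]
        exact pow_le_pow_left₀ (abs_nonneg _) h1 2
      rw [hy]
      nlinarith
    have hd := differentiableAt_integral_of_holomorphic (V := V) (E := SymMat n)
      (f := fun Z : SymMat n => F Z) isOpen_siegelH hF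
      ((ContinuousLinearMap.id ℂ ℂ).smulRight (⟨MC, hMCs⟩ : SymMat n))
      (γ := fun x : ℝ => (⟨Z, hZ.1⟩ : SymMat n) + ((x : ℂ) + y * Complex.I) • ⟨_, hECs⟩)
      (by fun_prop)
      (θ := fun x : ℝ => Complex.exp (-(2 * Real.pi * Complex.I * p * (x + y * Complex.I))))
      (by fun_prop) ζ₀ ?_
    · refine hd.congr_of_eventuallyEq ?_
      filter_upwards [Metric.ball_mem_nhds ζ₀ one_pos] with ζ hζ
      rw [mem_ball_iff_norm] at hζ
      rw [hψeq ζ y (hnear ζ hζ), fc]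
      refine intervalIntegral.integral_congr fun x _ => ?_
      simp only [hG]
      congr 2
      simp only [ContinuousLinearMap.smulRight_apply, ContinuousLinearMap.id_apply,
        Submodule.coe_add, Submodule.coe_smul]
      abel
    · intro x _
      have := hmem ζ₀ (x + y * Complex.I) (by simpa using hnear ζ₀ (by simp))
      have e : ζ₀ • MC + (Z + ((x : ℂ) + y * Complex.I) • single j j 1)
          = Z + ζ₀ • MC + ((x : ℂ) + y * Complex.I) • single j j 1 := by abel
      rw [← e] at this
      exact this
  -- At height `((Im ζ) ^ 2 + 1) η` the imaginary part is `U_b (Y + η E_jj) U_bᵗ` with `b = Im ζ`,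
  -- because transvections fix `E_jj`. The integral transvection with parameter `-⌊b⌋` brings it
  -- into the compact set below, at the cost of a factor `B ^ |⌊b⌋|`.
  obtain ⟨C, hC⟩ := exists_bound_of_isCompact_im hF hT
    (K := (fun b : ℝ => transvection j l b * Y * (transvection j l b)ᵀ + η • E) '' Set.Icc 0 1)
    (isCompact_Icc.image (by
      simp only [transvection_mul_mul_transpose]
      fun_prop))
    (by
      rintro _ ⟨b, -, rfl⟩
      exact (posDef_conj_transvection hjl hY _).add_posSemidef
        ((posSemidef_single j).smul hη.le))
  have hGb : ∀ (ζ : ℂ) (x : ℝ), ‖G ζ (x + ((ζ.im ^ 2 + 1) * η : ℝ) * Complex.I)‖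
      ≤ B ^ ⌊ζ.im⌋.natAbs * C := by
    intro ζ x
    have hw : ((x : ℂ) + ((ζ.im ^ 2 + 1) * η : ℝ) * Complex.I).im = (ζ.im ^ 2 + 1) * η := by
      rw [Complex.add_im, Complex.im_ofReal_mul]; simp
    have hm := hmem ζ (x + ((ζ.im ^ 2 + 1) * η : ℝ) * Complex.I) (by rw [hw]; nlinarith)
    have h1 := hU (-⌊ζ.im⌋) _ hm
    rw [Int.natAbs_neg] at h1
    refine h1.trans (mul_le_mul_of_nonneg_left (hC _ ?_ ?_) (by positivity))
    · refine ⟨?_, ?_⟩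
      · rw [IsSymm, transpose_mul, transpose_mul, ← transpose_map, ← transpose_map,
          transpose_transpose, hm.1.eq, Matrix.mul_assoc]
      · rw [map_im_mul_mul]
        exact posDef_conj_transvection hjl hm.2 _
    · refine ⟨Int.fract ζ.im, ⟨Int.fract_nonneg _, (Int.fract_lt_one _).le⟩, ?_⟩
      rw [map_im_mul_mul, him, hw, mul_add, add_mul, mul_smul_comm, smul_mul_assoc,
        transvection_mul_single_mul_transpose hjl]
      rw [← transvection_fract_conj hjl, show (ζ.im ^ 2 + 1) * η - ζ.im ^ 2 * η = η by ring]
  have hC0 : 0 ≤ C := by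
    have := (norm_nonneg _).trans (hGb 0 0)
    simpa using this
  have hpη : 0 < -(2 * Real.pi * p * η) := by
    have : (p : ℝ) < 0 := by exact_mod_cast hp
    have := mul_pos_of_neg_of_neg this (neg_lt_zero.2 (mul_pos Real.two_pi_pos hη))
    linarith
  obtain ⟨D, hD0, hD⟩ := exp_bound_of_quadratic hpη hB
  have hψb : ∀ ζ, ‖ψ ζ‖ ≤ Real.exp (2 * Real.pi * p * η) * C * D * Real.exp (-|ζ.im|) := by
    intro ζ
    refine (norm_fc_le _ p _ _ (hGb ζ)).trans ?_
    have e : Real.exp (2 * Real.pi * p * ((ζ.im ^ 2 + 1) * η)) =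
        Real.exp (2 * Real.pi * p * η) *
          Real.exp (-(-(2 * Real.pi * p * η) * ζ.im ^ 2)) := by
      rw [← Real.exp_add]; congr 1; ring
    rw [e]
    calc _ = Real.exp (2 * Real.pi * p * η) * C *
        (Real.exp (-(-(2 * Real.pi * p * η) * ζ.im ^ 2)) * B ^ ⌊ζ.im⌋.natAbs) := by ring
      _ ≤ Real.exp (2 * Real.pi * p * η) * C * (D * Real.exp (-|ζ.im|)) :=
        mul_le_mul_of_nonneg_left (hD _) (by positivity)
      _ = _ := by ring
  -- Liouville; the decay along the imaginary axis then forces the constant to be zero.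
  have hconst : ∀ ζ, ψ ζ = ψ 0 := by
    intro ζ
    refine hψd.apply_eq_apply_of_bounded (isBounded_iff_forall_norm_le.2
      ⟨Real.exp (2 * Real.pi * p * η) * C * D, ?_⟩) ζ 0
    rintro _ ⟨ζ, rfl⟩
    refine (hψb ζ).trans (mul_le_of_le_one_right (by positivity) ?_)
    exact Real.exp_le_one_iff.2 (neg_nonpos.2 (abs_nonneg _))
  have hlim : Tendsto (fun b : ℝ => Real.exp (2 * Real.pi * p * η) * C * D * Real.exp (-b)) atTop
      (𝓝 0) := by
    simpa using (Real.tendsto_exp_neg_atTop_nhds_zero.const_mul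
      (Real.exp (2 * Real.pi * p * η) * C * D))
  have hψ0 : ψ 0 = 0 := by
    refine norm_le_zero_iff.1 (ge_of_tendsto hlim ?_)
    filter_upwards [eventually_ge_atTop 0] with b hb
    have := hψb (b * Complex.I)
    rw [hconst] at this
    simpa [abs_of_nonneg hb] using this
  rw [hψeq 0 1 (by simp)] at hψ0
  simpa [hG] using hψ0

end FourierJacobi

/-! ### The maximum principle and convergence along diagonal directions. -/

section Boundedness

attribute [local instance] Matrix.normedAddCommGroup Matrix.normedSpace

variable {V : Type*} [NormedAddCommGroup V] [NormedSpace ℂ V]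

/-- The properties of a vector valued modular form of degree at least two that enter Koecher's
principle: holomorphy, integral periods, and quasi-invariance under elementary unipotents. -/
structure KoecherData {n : ℕ} (F : Matrix (Fin n) (Fin n) ℂ → V) : Prop where
  holo : DifferentiableOn ℂ (fun Z : SymMat n => F Z) {Z : SymMat n | Z.1 ∈ SiegelH n}
  period : ∀ S : Matrix (Fin n) (Fin n) ℤ, S.IsSymm → ∀ Z ∈ SiegelH n,
    F (Z + S.map (Int.cast : ℤ → ℂ)) = F Z
  unipotent : ∀ j : Fin n, ∃ l, j ≠ l ∧ ∃ B : ℝ, 1 ≤ B ∧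
    ∀ s : ℤ, ∀ Z ∈ SiegelH n, ‖F Z‖ ≤ B ^ s.natAbs *
      ‖F ((transvection j l (s : ℝ)).map Complex.ofReal * Z *
        ((transvection j l (s : ℝ))ᵀ).map Complex.ofReal)‖

variable {n : ℕ}

lemma add_smul_mem_siegelH {Z : Matrix (Fin n) (Fin n) ℂ} (hZ : Z ∈ SiegelH n)
    {N : Matrix (Fin n) (Fin n) ℝ} (hN : N.PosSemidef) {w : ℂ} (hw : 0 ≤ w.im) :
    Z + w • N.map Complex.ofReal ∈ SiegelH n := by
  have hNs : N.IsSymm := by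
    have := hN.1
    rwa [IsHermitian, conjTranspose_eq_transpose_of_trivial] at this
  refine ⟨hZ.1.add ((hNs.map _).smul w), ?_⟩
  rw [map_im_add_smul]
  exact hZ.2.add_posSemidef (hN.smul hw)

lemma single_map_ofReal (j : Fin n) :
    (single j j (1 : ℝ)).map Complex.ofReal = single j j (1 : ℂ) := by
  ext a b; simp only [map_apply, single_apply]; split_ifs <;> simp

variable [FiniteDimensional ℂ V] {F : Matrix (Fin n) (Fin n) ℂ → V}

/-- Without negative coefficients the function of `w` is bounded for `Im w ≥ 1`, and compactness
bounds it on the remaining strip. Phragmén–Lindelöf then improves this unspecified bound to the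
bound `C` on the real line. -/
lemma KoecherData.norm_le_add_single (hF : KoecherData F) {Z : Matrix (Fin n) (Fin n) ℂ}
    (hZ : Z ∈ SiegelH n) (j : Fin n) {C : ℝ} (hC : ∀ x : ℝ, ‖F (Z + (x : ℂ) • single j j 1)‖ ≤ C)
    {w : ℂ} (hw : 0 ≤ w.im) : ‖F (Z + w • single j j 1)‖ ≤ C := by
  obtain ⟨l, hjl, B, hB, hU⟩ := hF.unipotent j
  have hmem : ∀ w : ℂ, 0 ≤ w.im → Z + w • single j j 1 ∈ SiegelH n := fun w hw => by
    rw [← single_map_ofReal]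
    exact add_smul_mem_siegelH hZ (posSemidef_single j) hw
  have hd : ∀ w : ℂ, 0 ≤ w.im → DifferentiableAt ℂ (fun w : ℂ => F (Z + w • single j j 1)) w :=
    fun w hw => differentiableAt_line hF.holo hZ.1 (by rw [IsSymm, transpose_single]) (hmem w hw)
  have hp : ∀ w : ℂ, 0 < w.im → F (Z + (w + 1) • single j j 1) = F (Z + w • single j j 1) := by
    intro w hw
    have := hF.period (single j j 1) (by rw [IsSymm, transpose_single]) _ (hmem w hw.le)
    rw [← this, add_smul, one_smul, ← add_assoc]
    congr 2
    ext a b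
    simp only [map_apply, single_apply]; split_ifs <;> simp
  obtain ⟨D, hD0, hD⟩ := norm_sub_fc_zero_le (g := fun w => F (Z + w • single j j 1))
    (fun w hw => (hd w (le_of_lt hw)).differentiableWithinAt) hp
    (fun p hp => fc_single_eq_zero hF.holo hF.period hjl hB hU hZ hp)
  obtain ⟨A, hA⟩ := exists_bound_of_isCompact_im hF.holo hF.period
    (K := (fun t : ℝ => Z.map Complex.im + t • single j j 1) '' Set.Icc 0 1)
    (isCompact_Icc.image (by fun_prop))
    (by
      rintro _ ⟨t, ht, rfl⟩
      exact hZ.2.add_posSemidef ((posSemidef_single j).smul ht.1))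
  refine norm_le_of_bounded_of_real (g := fun w => F (Z + w • single j j 1)) hd
    (B := max A (D + ‖fc (fun w => F (Z + w • single j j 1)) 0 1‖)) (fun w hw => ?_) hC hw
  rcases le_total w.im 1 with h1 | h1
  · refine (hA _ (hmem w hw) ⟨w.im, ⟨hw, h1⟩, ?_⟩).trans (le_max_left _ _)
    rw [← single_map_ofReal, map_im_add_smul]
  · refine le_trans ?_ (le_max_right _ _)
    have h2 := norm_le_norm_sub_add (F (Z + w • single j j 1))
      (fc (fun w => F (Z + w • single j j 1)) 0 1)
    have h3 : D * Real.exp (-(2 * Real.pi * w.im)) ≤ D :=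
      mul_le_of_le_one_right hD0 (Real.exp_le_one_iff.2 (by
        have := Real.pi_pos
        have : 0 ≤ 2 * Real.pi * w.im := by positivity
        linarith))
    linarith [hD w h1]

/-- Koecher's principle as a maximum principle: a bound on a slice `Im Z = Y` persists when the
diagonal of `Y` increases. -/
lemma KoecherData.norm_le_add_diagonal (hF : KoecherData F) {Y : Matrix (Fin n) (Fin n) ℝ}
    (hY : Y.PosDef) {C : ℝ} (hC : ∀ Z ∈ SiegelH n, Z.map Complex.im = Y → ‖F Z‖ ≤ C)
    {t : Fin n → ℝ} (ht : ∀ i, 0 ≤ t i) {Z : Matrix (Fin n) (Fin n) ℂ} (hZ : Z ∈ SiegelH n)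
    (hZY : Z.map Complex.im = Y + diagonal t) : ‖F Z‖ ≤ C := by
  -- The diagonal entries are raised one at a time; the inductive hypothesis bounds the whole real
  -- line over which the next entry is raised.
  have key : ∀ s : Finset (Fin n), ∀ Z ∈ SiegelH n,
      Z.map Complex.im = Y + ∑ i ∈ s, t i • single i i 1 → ‖F Z‖ ≤ C := by
    intro s
    induction s using Finset.induction_on with
    | empty => intro Z hZ h; exact hC Z hZ (by simpa using h)
    | insert j s hj ih =>
      intro Z hZ h
      set Z' := Z + (-(t j * Complex.I)) • single j j 1 with hZ'
      have him : ∀ x : ℝ, (Z' + (x : ℂ) • single j j 1).map Complex.im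
          = Y + ∑ i ∈ s, t i • single i i 1 := by
        intro x
        rw [← single_map_ofReal, map_im_add_smul, hZ', ← single_map_ofReal, map_im_add_smul, h,
          Finset.sum_insert hj]
        simp
        abel
      have hpos : (Y + ∑ i ∈ s, t i • single i i 1).PosDef :=
        hY.add_posSemidef (Matrix.posSemidef_sum _ fun i _ => (posSemidef_single i).smul (ht i))
      have hsymm : ∀ w : ℂ, (w • single j j (1 : ℂ)).IsSymm := fun w => by
        rw [IsSymm, transpose_smul, transpose_single]
      have hm : ∀ x : ℝ, Z' + (x : ℂ) • single j j 1 ∈ SiegelH n := fun x =>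
        ⟨(hZ.1.add (hsymm _)).add (hsymm _), by rw [him]; exact hpos⟩
      have h0 := hm 0
      rw [Complex.ofReal_zero, zero_smul, add_zero] at h0
      have := hF.norm_le_add_single h0 j (C := C) (fun x => ih _ (hm x) (him x))
        (w := t j * Complex.I) (by simpa using ht j)
      simpa [hZ'] using this
  refine key Finset.univ Z hZ ?_
  rw [hZY]
  congr 1
  ext a b
  simp only [Matrix.sum_apply, diagonal_apply, Matrix.smul_apply, single_apply, smul_eq_mul, mul_ite,
    mul_one, mul_zero]
  by_cases hab : a = b
  · subst hab; simp
  · rw [if_neg hab]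
    exact (Finset.sum_eq_zero fun c _ => if_neg fun h => hab (h.1.symm.trans h.2)).symm

/-- The limit of `F` along `Z + i t N`, `t → ∞`, for `N` integral diagonal and positive
semidefinite. -/
lemma KoecherData.tendsto_diagonal (hF : KoecherData F) {Z : Matrix (Fin n) (Fin n) ℂ}
    (hZ : Z ∈ SiegelH n) (d : Fin n → ℕ) :
    Tendsto (fun t : ℝ => F (Z + (t * Complex.I) • diagonal fun i => (d i : ℂ))) atTop
      (𝓝 (fc (fun w => F (Z + w • diagonal fun i => (d i : ℂ))) 0 1)) := by
  set N : Matrix (Fin n) (Fin n) ℂ := diagonal fun i => (d i : ℂ) with hN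
  have hNr : (diagonal fun i => (d i : ℝ)).map Complex.ofReal = N := by
    rw [diagonal_map (by simp)]; simp [hN]
  have hNs : N.IsSymm := isSymm_diagonal _
  have hmem : ∀ w : ℂ, 0 ≤ w.im → Z + w • N ∈ SiegelH n := fun w hw => by
    rw [← hNr]
    exact add_smul_mem_siegelH hZ (PosSemidef.diagonal fun i => by positivity) hw
  have hd : ∀ w : ℂ, 0 ≤ w.im → DifferentiableAt ℂ (fun w : ℂ => F (Z + w • N)) w :=
    fun w hw => differentiableAt_line hF.holo hZ.1 hNs (hmem w hw)
  have hp : ∀ w : ℂ, 0 < w.im → F (Z + (w + 1) • N) = F (Z + w • N) := by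
    intro w hw
    have := hF.period (diagonal fun i => (d i : ℤ)) (isSymm_diagonal _) _ (hmem w hw.le)
    rw [← this, add_smul, one_smul, ← add_assoc]
    congr 2
    rw [diagonal_map (by simp)]; simp [hN]
  obtain ⟨C, hC⟩ := exists_bound_of_isCompact_im hF.holo hF.period
    (K := {Z.map Complex.im}) isCompact_singleton (by rintro _ rfl; exact hZ.2)
  have hb : ∀ w : ℂ, 1 ≤ w.im → ‖F (Z + w • N)‖ ≤ C := by
    intro w hw
    refine hF.norm_le_add_diagonal hZ.2 (C := C) (fun Z hZ h => hC Z hZ h)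
      (t := fun i => w.im * d i) (fun i => by positivity) (hmem w (by linarith)) ?_
    rw [← hNr, map_im_add_smul]
    congr 1
    ext a b
    simp [diagonal_apply]
  have hdiff : DifferentiableOn ℂ (fun w : ℂ => F (Z + w • N)) {w | 0 < w.im} := fun w hw =>
    (hd w (le_of_lt hw)).differentiableWithinAt
  obtain ⟨D, hD0, hD⟩ := norm_sub_fc_zero_le (g := fun w => F (Z + w • N)) hdiff hp
    (fun p hneg => fc_eq_zero_of_bounded hdiff hp hb hneg)
  rw [tendsto_iff_norm_sub_tendsto_zero]
  have hlim : Tendsto (fun t : ℝ => D * Real.exp (-(2 * Real.pi * t))) atTop (𝓝 (D * 0)) :=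
    (Real.tendsto_exp_neg_atTop_nhds_zero.comp
      (tendsto_id.const_mul_atTop Real.two_pi_pos)).const_mul D
  rw [mul_zero] at hlim
  refine squeeze_zero' (Eventually.of_forall fun t => norm_nonneg _) ?_ hlim
  filter_upwards [eventually_ge_atTop 1] with t ht
  simpa using hD (t * Complex.I) (by simpa using ht)

end Boundedness

/-! ### Weyl's unitarian trick: from `U(m)` to `GL(m, ℂ)`. -/

section Unitarian

open scoped ComplexOrder

/-- A singular value decomposition of an invertible complex matrix. -/
lemma exists_unitary_mul_diagonal_mul_unitary {m : ℕ} (A : GL (Fin m) ℂ) :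
    ∃ (U W : GL (Fin m) ℂ) (d : Fin m → ℂ) (D : GL (Fin m) ℂ),
      (U : Matrix (Fin m) (Fin m) ℂ) ∈ unitaryGroup (Fin m) ℂ ∧
      (W : Matrix (Fin m) (Fin m) ℂ) ∈ unitaryGroup (Fin m) ℂ ∧
      (D : Matrix (Fin m) (Fin m) ℂ) = diagonal d ∧ A = U * D * W := by
  set a : Matrix (Fin m) (Fin m) ℂ := A.1
  have hu : IsUnit a := A.isUnit
  have hpos : (aᴴ * a).PosDef :=
    PosDef.conjTranspose_mul_self a (mulVec_injective_of_isUnit hu)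
  set W := (hpos.1.eigenvectorUnitary : Matrix (Fin m) (Fin m) ℂ) with hW
  have hWu : W ∈ unitaryGroup (Fin m) ℂ := hpos.1.eigenvectorUnitary.2
  have h1 : Wᴴ * W = 1 := mem_unitaryGroup_iff'.1 hWu
  have h2 : W * Wᴴ = 1 := mem_unitaryGroup_iff.1 hWu
  set lam := hpos.1.eigenvalues
  have hlam : ∀ i, 0 < lam i := hpos.eigenvalues_pos
  have hspec : Wᴴ * (aᴴ * a) * W = diagonal fun i => (lam i : ℂ) := by
    have := hpos.1.conjStarAlgAut_star_eigenvectorUnitary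
    rw [Unitary.conjStarAlgAut_star_apply] at this
    exact this
  set d : Fin m → ℂ := fun i => (Real.sqrt (lam i) : ℂ)
  have hd0 : ∀ i, d i ≠ 0 := fun i => by
    simpa [d] using (Real.sqrt_pos.2 (hlam i)).ne'
  have hdd : (diagonal d : Matrix (Fin m) (Fin m) ℂ) * diagonal d⁻¹ = 1 := by
    rw [diagonal_mul_diagonal, ← diagonal_one]
    congr 1; ext i; simp [hd0 i]
  have hdd' : (diagonal d⁻¹ : Matrix (Fin m) (Fin m) ℂ) * diagonal d = 1 := by
    rw [diagonal_mul_diagonal, ← diagonal_one]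
    congr 1; ext i; simp [hd0 i]
  set U := a * W * diagonal d⁻¹ with hU
  have hUu : Uᴴ * U = 1 := by
    have e : (diagonal d⁻¹)ᴴ = (diagonal d⁻¹ : Matrix (Fin m) (Fin m) ℂ) := by
      rw [diagonal_conjTranspose]; congr 1; ext i; simp [d]
    have : Uᴴ * U = diagonal d⁻¹ * (Wᴴ * (aᴴ * a) * W) * diagonal d⁻¹ := by
      rw [hU, conjTranspose_mul, conjTranspose_mul, e]
      simp only [Matrix.mul_assoc]
    rw [this, hspec, diagonal_mul_diagonal, diagonal_mul_diagonal, ← diagonal_one]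
    congr 1; ext i
    have h3 : (lam i : ℂ) = d i * d i := by
      simp only [d]
      rw [← Complex.ofReal_mul, Real.mul_self_sqrt (hlam i).le]
    rw [h3]
    simp [hd0 i]
  have hUu' : U * Uᴴ = 1 := mul_eq_one_comm.1 hUu
  refine ⟨⟨U, Uᴴ, hUu', hUu⟩, ⟨Wᴴ, W, h1, h2⟩, d, ⟨diagonal d, diagonal d⁻¹, hdd, hdd'⟩,
    mem_unitaryGroup_iff'.2 hUu, ?_, rfl, ?_⟩
  · rw [mem_unitaryGroup_iff, star_eq_conjTranspose, conjTranspose_conjTranspose]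
    exact h1
  · ext1
    change a = U * diagonal d * Wᴴ
    rw [hU, Matrix.mul_assoc (a * W), hdd', Matrix.mul_one, Matrix.mul_assoc, h2, Matrix.mul_one]

variable {V : Type*} [NormedAddCommGroup V] [NormedSpace ℂ V]

lemma embGL_mul {m n : ℕ} (h : m < n) (A B : GL (Fin m) ℂ) :
    embGL h (A * B) = embGL h A * embGL h B := by
  ext1
  change blk h (A.1 * B.1) 1 = blk h A.1 1 * blk h B.1 1
  rw [blk_mul, one_mul]

/-- Makes the compact torus Zariski dense: a polynomial vanishing on a product of infinite sets is
zero. -/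
lemma infinite_unit_circle : {z : ℂ | z * star z = 1}.Infinite := by
  have h : (Metric.sphere (0 : ℂ) 1).Infinite := by
    refine (isPreconnected_sphere (by simp) 0 1).infinite_of_nontrivial
      ⟨1, by simp, -1, by simp, ?_⟩
    norm_num
  refine h.mono fun z hz => ?_
  have hz1 : ‖z‖ = 1 := by simpa using hz
  change z * (starRingEnd ℂ) z = 1
  rw [Complex.mul_conj, Complex.normSq_eq_norm_sq, hz1]
  simp

/-- The polynomial function on diagonal matrices defined by a polynomial in matrix entries. -/
noncomputable def restrictDiag {m n : ℕ} (e : Fin n → Option (Fin m))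
    (P : MvPolynomial (Fin n × Fin n) ℂ) : MvPolynomial (Fin m) ℂ :=
  MvPolynomial.bind₁ (fun p => if p.1 = p.2 then (e p.1).elim 1 MvPolynomial.X else 0) P

lemma eval_restrictDiag {m n : ℕ} (e : Fin n → Option (Fin m))
    (P : MvPolynomial (Fin n × Fin n) ℂ) (d : Fin m → ℂ) :
    MvPolynomial.eval d (restrictDiag e P) = MvPolynomial.eval
      (fun p => (diagonal fun i => (e i).elim 1 d : Matrix (Fin n) (Fin n) ℂ) p.1 p.2) P := by
  rw [restrictDiag, ← MvPolynomial.coe_aeval_eq_eval, RingHom.coe_coe, MvPolynomial.aeval_bind₁,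
    ← MvPolynomial.coe_aeval_eq_eval, RingHom.coe_coe]
  congr 2
  ext p
  obtain ⟨a, b⟩ := p
  by_cases hp : a = b
  · subst hp
    rcases he : e a with _ | c <;> simp [he]
  · simp [hp]

/-- The compatibility of a stable representation extends from `U(m)` to `GL(m, ℂ)`. -/
lemma StableRep.compat_GL (ρ : StableRep V) {m n : ℕ} (h : m < n) (A : GL (Fin m) ℂ) :
    ρ.rep m A = ρ.rep n (embGL h A) := by
  obtain ⟨U, W, d, D, hU, hW, hD, rfl⟩ := exists_unitary_mul_diagonal_mul_unitary A
  rw [embGL_mul, embGL_mul, map_mul, map_mul, map_mul, map_mul, ← ρ.compat h U hU,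
    ← ρ.compat h W hW]
  -- The unitary factors of the singular value decomposition are settled by hypothesis; only the
  -- diagonal factor remains.
  congr 2
  clear hU hW U W
  ext v
  rw [← sub_eq_zero]
  refine (Module.forall_dual_apply_eq_zero_iff ℂ _).1 fun φ => ?_
  rw [map_sub, sub_eq_zero]
  obtain ⟨P, k, hP⟩ := ρ.rational m φ v
  obtain ⟨P', k', hP'⟩ := ρ.rational n φ v
  set e : Fin n → Option (Fin m) := fun i => ((splitEquiv h).symm i).elim some fun _ => none
  have hblk : ∀ d : Fin m → ℂ, blk h (diagonal d) (1 : Matrix (Fin (n - m)) (Fin (n - m)) ℂ)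
      = diagonal fun i => (e i).elim 1 d := by
    intro d
    rw [blk, ← diagonal_one, fromBlocks_diagonal, reindex_apply, submatrix_diagonal_equiv]
    congr 1
    ext i
    rcases hi : (splitEquiv h).symm i with a | a <;> simp [e, hi]
  have hdet : ∀ d : Fin m → ℂ,
      (diagonal fun i => (e i).elim 1 d : Matrix (Fin n) (Fin n) ℂ).det = ∏ i, d i := by
    intro d
    rw [← hblk, blk, det_reindex_self, det_fromBlocks_zero₂₁, det_diagonal, det_one, mul_one]
  have hPd : ∀ (d : Fin m → ℂ) (D : GL (Fin m) ℂ), D.1 = diagonal d →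
      φ (ρ.rep m D v) = MvPolynomial.eval d (restrictDiag some P) / (∏ i, d i) ^ k := by
    intro d D hD
    rw [hP, eval_restrictDiag]
    simp only [hD, det_diagonal, Option.elim_some]
  have hPd' : ∀ (d : Fin m → ℂ) (D : GL (Fin m) ℂ), D.1 = diagonal d →
      φ (ρ.rep n (embGL h D) v) =
        MvPolynomial.eval d (restrictDiag e P') / (∏ i, d i) ^ k' := by
    intro d D hD
    have : (embGL h D).1 = diagonal fun i => (e i).elim 1 d := by
      rw [← hblk, ← hD]; rfl
    rw [hP', eval_restrictDiag, this, hdet]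
  have hne : ∀ (d : Fin m → ℂ) (D : GL (Fin m) ℂ), D.1 = diagonal d → ∏ i, d i ≠ 0 := by
    intro d D hD
    rw [← det_diagonal, ← hD]
    exact (isUnit_iff_isUnit_det _).1 D.isUnit |>.ne_zero
  set π : MvPolynomial (Fin m) ℂ := ∏ i, MvPolynomial.X i with hπ
  have hπe : ∀ d : Fin m → ℂ, MvPolynomial.eval d π = ∏ i, d i := fun d => by simp [hπ]
  -- With determinants cleared, both matrix coefficients are polynomials on the diagonal. They agree
  -- on the unitary torus, hence everywhere.
  have key : restrictDiag some P * π ^ k' = restrictDiag e P' * π ^ k := by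
    refine MvPolynomial.funext_set (fun _ => {z : ℂ | z * star z = 1})
      (fun _ => infinite_unit_circle) fun d hd => ?_
    have hd1 : ∀ i, d i * star (d i) = 1 := fun i => hd i (Set.mem_univ i)
    have hu : (diagonal d : Matrix (Fin m) (Fin m) ℂ) * (diagonal d)ᴴ = 1 := by
      rw [diagonal_conjTranspose, diagonal_mul_diagonal, ← diagonal_one]
      congr 1; ext i; exact hd1 i
    set D' : GL (Fin m) ℂ := ⟨diagonal d, (diagonal d)ᴴ, hu, mul_eq_one_comm.1 hu⟩
    have h1 := congrArg (fun L => φ (L v)) (ρ.compat h D' (mem_unitaryGroup_iff.2 hu))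
    rw [hPd d D' rfl, hPd' d D' rfl, div_eq_div_iff (pow_ne_zero _ (hne d D' rfl))
      (pow_ne_zero _ (hne d D' rfl))] at h1
    simpa [hπe] using h1
  rw [hPd d D hD, hPd' d D hD, div_eq_div_iff (pow_ne_zero _ (hne d D hD))
      (pow_ne_zero _ (hne d D hD))]
  simpa [hπe] using congrArg (MvPolynomial.eval d) key

end Unitarian

/-! ### Translations and unipotents in the modular group. -/

section ModularGroup

variable {n : ℕ}

lemma act_val_eq {g : Sp n} {Z : SiegelH n} {W : Matrix (Fin n) (Fin n) ℂ}
    (h : num g Z.1 = W * denom g Z.1) : (act g Z).1 = W := by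
  change num g Z.1 * (denom g Z.1)⁻¹ = W
  rw [h, Matrix.mul_assoc, mul_nonsing_inv _ (denom_det_ne_zero g Z).isUnit, Matrix.mul_one]

lemma act_val_mul_denom (g : Sp n) (Z : SiegelH n) :
    (act g Z).1 * denom g Z.1 = num g Z.1 := by
  change num g Z.1 * (denom g Z.1)⁻¹ * denom g Z.1 = _
  rw [Matrix.mul_assoc, nonsing_inv_mul _ (denom_det_ne_zero g Z).isUnit, Matrix.mul_one]

lemma num_ofInt_fromBlocks {A B C D : Matrix (Fin n) (Fin n) ℤ}
    (h : fromBlocks A B C D ∈ symplecticGroup (Fin n) ℤ) (Z : Matrix (Fin n) (Fin n) ℂ) :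
    num (ofInt ⟨_, h⟩) Z = A.map (Int.cast : ℤ → ℂ) * Z + B.map (Int.cast : ℤ → ℂ) := by
  simp only [num, ofInt, fromBlocks_map, toBlocks_fromBlocks₁₁, toBlocks_fromBlocks₁₂]
  congr 1

lemma denom_ofInt_fromBlocks {A B C D : Matrix (Fin n) (Fin n) ℤ}
    (h : fromBlocks A B C D ∈ symplecticGroup (Fin n) ℤ) (Z : Matrix (Fin n) (Fin n) ℂ) :
    denom (ofInt ⟨_, h⟩) Z = C.map (Int.cast : ℤ → ℂ) * Z + D.map (Int.cast : ℤ → ℂ) := by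
  simp only [denom, ofInt, fromBlocks_map, toBlocks_fromBlocks₂₁, toBlocks_fromBlocks₂₂]
  congr 1

lemma translation_mem {S : Matrix (Fin n) (Fin n) ℤ} (hS : S.IsSymm) :
    fromBlocks 1 S 0 1 ∈ symplecticGroup (Fin n) ℤ := by
  rw [SymplecticGroup.fromBlocks_mem_iff]
  simp [hS.eq]

lemma transvection_transpose {R : Type*} [CommRing R] (j l : Fin n) (c : R) :
    (transvection j l c)ᵀ = transvection l j c := by
  rw [transvection, transpose_add, transpose_one, transpose_single, transvection]

lemma transvection_map {R S : Type*} [CommRing R] [CommRing S] (f : R →+* S) (j l : Fin n)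
    (c : R) : (transvection j l c).map f = transvection j l (f c) := by
  ext a b
  simp only [transvection, map_apply, Matrix.add_apply, single_apply, one_apply, map_add]
  split_ifs <;> simp

lemma unipotent_mem {j l : Fin n} (h : j ≠ l) (s : ℤ) :
    fromBlocks (transvection j l s) 0 0 (transvection l j (-s)) ∈ symplecticGroup (Fin n) ℤ := by
  rw [SymplecticGroup.fromBlocks_mem_iff]
  simp [transvection_transpose, transvection_mul_transvection_same _ _ h.symm]

/-- The one parameter group `s ↦ 1 - s E_{lj}` in `GL(n, ℂ)`. -/
def unipotentHom {j l : Fin n} (h : j ≠ l) : Multiplicative ℤ →* GL (Fin n) ℂ where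
  toFun s := ⟨transvection l j (-(s.toAdd : ℂ)), transvection l j (s.toAdd : ℂ),
    by simp [transvection_mul_transvection_same _ _ h.symm],
    by simp [transvection_mul_transvection_same _ _ h.symm]⟩
  map_one' := by ext1; simp
  map_mul' s t := by
    ext1
    change transvection l j _ = transvection l j _ * transvection l j _
    rw [transvection_mul_transvection_same _ _ h.symm]
    congr 1
    simp
    ring

variable {V : Type*} [NormedAddCommGroup V] [NormedSpace ℂ V]

/-- Operator norms are submultiplicative; taking the larger of those of `T` and `T⁻¹` covers both
signs of the exponent. This supplies the constant `B` in `KoecherData`. -/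
lemma exists_norm_zpow_le [FiniteDimensional ℂ V] (T : V ≃ₗ[ℂ] V) :
    ∃ B : ℝ, 1 ≤ B ∧ ∀ (s : ℤ) (v : V), ‖(T ^ s) v‖ ≤ B ^ s.natAbs * ‖v‖ := by
  have hpow : ∀ (T : V ≃ₗ[ℂ] V) (B : ℝ), 0 ≤ B → (∀ v, ‖T v‖ ≤ B * ‖v‖) →
      ∀ (k : ℕ) (v : V), ‖(T ^ k) v‖ ≤ B ^ k * ‖v‖ := by
    intro T B hB hT k
    induction k with
    | zero => intro v; simp
    | succ k ih =>
      intro v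
      rw [pow_succ', pow_succ', mul_assoc]
      exact (hT _).trans (mul_le_mul_of_nonneg_left (ih v) hB)
  set c := fun T : V ≃ₗ[ℂ] V => ‖LinearMap.toContinuousLinearMap (T : V →ₗ[ℂ] V)‖
  have hc : ∀ (T : V ≃ₗ[ℂ] V) (v : V), ‖T v‖ ≤ c T * ‖v‖ := fun T v =>
    (LinearMap.toContinuousLinearMap (T : V →ₗ[ℂ] V)).le_opNorm v
  have hB : 1 ≤ max 1 (max (c T) (c T⁻¹)) := le_max_left _ _
  refine ⟨max 1 (max (c T) (c T⁻¹)), hB, fun s v => ?_⟩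
  rcases Int.natAbs_eq s with h | h
  · conv_lhs => rw [h]
    rw [zpow_natCast]
    exact hpow T _ (by linarith) (fun v => (hc T v).trans (mul_le_mul_of_nonneg_right
      ((le_max_left _ _).trans (le_max_right _ _)) (norm_nonneg v))) _ v
  · conv_lhs => rw [h]
    rw [_root_.zpow_neg, zpow_natCast, ← inv_pow]
    exact hpow T⁻¹ _ (by linarith) (fun v => (hc T⁻¹ v).trans (mul_le_mul_of_nonneg_right
      ((le_max_right _ _).trans (le_max_right _ _)) (norm_nonneg v))) _ v

/-- The extension by zero of a function on the Siegel upper half plane. -/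
noncomputable abbrev extZero (f : SiegelH n → V) : Matrix (Fin n) (Fin n) ℂ → V :=
  Function.extend Subtype.val f 0

/-- Translations have trivial automorphy factor. For `(U 0; 0 ᵗU⁻¹)` with `U` an integral
transvection, the action is `Z ↦ U Z ᵗU` and the factor is the `s`-th power of one fixed
automorphism of `V`. The degree must be at least two for an index `l ≠ j` to exist. -/
lemma koecherData_of_modForms [FiniteDimensional ℂ V] (hn : 2 ≤ n)
    {ρ : GL (Fin n) ℂ →* (V ≃ₗ[ℂ] V)} {f : SiegelH n → V} (hf : f ∈ modForms ρ) :
    KoecherData (extZero f) where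
  holo := hf.1
  period S hS Z hZ := by
    have h := hf.2.1 ⟨_, translation_mem hS⟩ ⟨Z, hZ⟩
    have hden : denom (ofInt ⟨_, translation_mem hS⟩) Z = 1 := by
      rw [denom_ofInt_fromBlocks]; simp
    have hact : (act (ofInt ⟨_, translation_mem hS⟩) ⟨Z, hZ⟩).1
        = Z + S.map (Int.cast : ℤ → ℂ) := by
      refine act_val_eq ?_
      rw [hden, num_ofInt_fromBlocks]; simp
    have hgl : denomGL (ofInt ⟨_, translation_mem hS⟩) ⟨Z, hZ⟩ = 1 := Units.ext hden
    rw [autJ, hgl, map_one] at h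
    rw [extZero, ← hact, extend_apply _ (Subtype.property _), extend_apply _ hZ]
    exact h
  unipotent j := by
    obtain ⟨l, hl⟩ : ∃ l : Fin n, l ≠ j := by
      have : Nontrivial (Fin n) := Fin.nontrivial_iff_two_le.2 hn
      exact exists_ne j
    obtain ⟨B, hB, hBs⟩ := exists_norm_zpow_le (ρ (unipotentHom hl.symm (Multiplicative.ofAdd 1)))
    refine ⟨l, hl.symm, B, hB, fun s Z hZ => ?_⟩
    have h := hf.2.1 ⟨_, unipotent_mem hl.symm s⟩ ⟨Z, hZ⟩
    have hmap : ∀ (a b : Fin n) (c : ℤ), (transvection a b c).map (Int.cast : ℤ → ℂ)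
        = transvection a b (c : ℂ) := fun a b c => transvection_map (Int.castRingHom ℂ) a b c
    have hmap' : ∀ (a b : Fin n) (c : ℤ), (transvection a b (c : ℝ)).map Complex.ofReal
        = transvection a b (c : ℂ) := fun a b c => by
      have := transvection_map Complex.ofRealHom a b (c : ℝ)
      rwa [Complex.ofRealHom_eq_coe, Complex.ofReal_intCast] at this
    have hden : denom (ofInt ⟨_, unipotent_mem hl.symm s⟩) Z = transvection l j (-(s : ℂ)) := by
      rw [denom_ofInt_fromBlocks, hmap]; simp
    have hact : (act (ofInt ⟨_, unipotent_mem hl.symm s⟩) ⟨Z, hZ⟩).1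
        = (transvection j l (s : ℝ)).map Complex.ofReal * Z *
        ((transvection j l (s : ℝ))ᵀ).map Complex.ofReal := by
      refine act_val_eq ?_
      rw [hden, num_ofInt_fromBlocks, hmap, transvection_transpose, hmap', hmap', Matrix.mul_assoc,
        transvection_mul_transvection_same _ _ hl]
      simp
    have hgl : denomGL (ofInt ⟨_, unipotent_mem hl.symm s⟩) ⟨Z, hZ⟩
        = unipotentHom hl.symm (Multiplicative.ofAdd 1) ^ s := by
      rw [← map_zpow, ← ofAdd_zsmul, smul_eq_mul, mul_one]
      exact Units.ext hden
    rw [autJ, hgl, map_zpow] at h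
    have h2 : f ⟨Z, hZ⟩ = (ρ (unipotentHom hl.symm (Multiplicative.ofAdd 1)) ^ (-s))
        (f (act (ofInt ⟨_, unipotent_mem hl.symm s⟩) ⟨Z, hZ⟩)) := by
      rw [h, ← LinearEquiv.mul_apply, ← _root_.zpow_add, neg_add_cancel, zpow_zero]
      rfl
    rw [← hact, extZero, extend_apply _ hZ, extend_apply _ (Subtype.property _), h2]
    simpa using hBs (-s) (f (act (ofInt ⟨_, unipotent_mem hl.symm s⟩) ⟨Z, hZ⟩))

end ModularGroup

/-! ### Block embeddings and their actions. -/

section Embeddings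

variable {m n : ℕ} (h : m < n)

lemma blk_add {R : Type*} [CommRing R] (X X' : Matrix (Fin m) (Fin m) R)
    (Y Y' : Matrix (Fin (n - m)) (Fin (n - m)) R) :
    blk h X Y + blk h X' Y' = blk h (X + X') (Y + Y') := by
  ext i j
  rcases hi : (splitEquiv h).symm i with a | a <;> rcases hj : (splitEquiv h).symm j with b | b <;>
    simp [blk, hi, hj]

lemma blk_smul {R : Type*} [CommRing R] (c : R) (X : Matrix (Fin m) (Fin m) R)
    (Y : Matrix (Fin (n - m)) (Fin (n - m)) R) : c • blk h X Y = blk h (c • X) (c • Y) := by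
  ext i j
  rcases hi : (splitEquiv h).symm i with a | a <;> rcases hj : (splitEquiv h).symm j with b | b <;>
    simp [blk, hi, hj]

lemma blk_map {R S : Type*} [Zero R] [Zero S] (f : R → S) (hf : f 0 = 0)
    (X : Matrix (Fin m) (Fin m) R) (Y : Matrix (Fin (n - m)) (Fin (n - m)) R) :
    (blk h X Y).map f = blk h (X.map f) (Y.map f) := by
  ext i j
  rcases hi : (splitEquiv h).symm i with a | a <;> rcases hj : (splitEquiv h).symm j with b | b <;>
    simp [blk, hi, hj, hf]

lemma blk_diagonal {R : Type*} [Zero R] (d : Fin m → R) (d' : Fin (n - m) → R) :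
    blk h (diagonal d) (diagonal d') =
      diagonal fun i => Sum.elim d d' ((splitEquiv h).symm i) := by
  rw [blk, fromBlocks_diagonal, reindex_apply, submatrix_diagonal_equiv]
  rfl

/-- The coordinates transversal to the Siegel operator. -/
def transversal (i : Fin n) : ℕ := Sum.elim (fun _ => 0) (fun _ => 1) ((splitEquiv h).symm i)

lemma diagonal_transversal :
    (diagonal fun i => (transversal h i : ℂ)) = blk h (0 : Matrix (Fin m) (Fin m) ℂ) 1 := by
  rw [← diagonal_zero, ← diagonal_one, blk_diagonal]
  congr 1
  ext i
  rcases hi : (splitEquiv h).symm i with a | a <;> simp [transversal, hi]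

/-- The embedding `(A B; C D) ↦ (A 0 B 0; 0 1 0 0; C 0 D 0; 0 0 0 1)` of modular groups. -/
lemma embInt_mem {A B C D : Matrix (Fin m) (Fin m) ℤ}
    (hγ : fromBlocks A B C D ∈ symplecticGroup (Fin m) ℤ) :
    fromBlocks (blk h A 1) (blk h B 0) (blk h C 0) (blk h D 1) ∈ symplecticGroup (Fin n) ℤ := by
  rw [SymplecticGroup.fromBlocks_mem_iff] at hγ ⊢
  simp [blk_transpose, blk_mul, blk_sub, hγ, blk_one]

lemma denom_embInt {A B C D : Matrix (Fin m) (Fin m) ℤ}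
    (hγ : fromBlocks A B C D ∈ symplecticGroup (Fin m) ℤ) (Z : SiegelH m)
    (t : Set.Ioi (0 : ℝ)) :
    denom (ofInt ⟨_, embInt_mem h hγ⟩) (embPt h Z t).1 = blk h (denom (ofInt ⟨_, hγ⟩) Z.1) 1 := by
  rw [denom_ofInt_fromBlocks (embInt_mem h hγ), denom_ofInt_fromBlocks hγ, embPt]
  simp [blk_map, blk_mul, blk_add]

lemma act_embInt {A B C D : Matrix (Fin m) (Fin m) ℤ}
    (hγ : fromBlocks A B C D ∈ symplecticGroup (Fin m) ℤ) (Z : SiegelH m)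
    (t : Set.Ioi (0 : ℝ)) :
    act (ofInt ⟨_, embInt_mem h hγ⟩) (embPt h Z t) = embPt h (act (ofInt ⟨_, hγ⟩) Z) t := by
  refine Subtype.ext (act_val_eq ?_)
  rw [denom_embInt h hγ, num_ofInt_fromBlocks]
  simp only [embPt]
  rw [blk_mul, act_val_mul_denom, num_ofInt_fromBlocks]
  simp [blk_map, blk_mul, blk_add]

/-- On the complementary block the action sends `i` to `t^{1/2} i / t^{-1/2} = i t`, so the path
`g_t` on the group matches the path of `Φ` on the half plane. -/
lemma act_embSp (g : Sp m) (t : Set.Ioi (0 : ℝ)) :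
    act (embSp h g t) (basePt n) = embPt h (act g (basePt m)) t := by
  have ht : (0 : ℝ) < t.1 := t.2
  have hI : (basePt n).1 = blk h (Complex.I • 1) (Complex.I • 1) := by
    rw [← blk_smul, blk_one]; rfl
  have hd : denom (embSp h g t) (basePt n).1 =
      blk h (denom g (basePt m).1) (((Real.sqrt t.1)⁻¹ : ℂ) • 1) := by
    rw [hI, denom, embSp]
    simp only [toBlocks_fromBlocks₂₁, toBlocks_fromBlocks₂₂, blk_map _ _ (map_zero _), blk_mul,
      blk_add]
    congr 1
    ext i j
    simp [Matrix.one_apply, apply_ite Complex.ofReal]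
  have hn : num (embSp h g t) (basePt n).1 =
      blk h (num g (basePt m).1) ((Real.sqrt t.1 * Complex.I : ℂ) • 1) := by
    rw [hI, num, embSp]
    simp only [toBlocks_fromBlocks₁₁, toBlocks_fromBlocks₁₂, blk_map _ _ (map_zero _), blk_mul,
      blk_add]
    congr 1
    ext i j
    by_cases hij : i = j <;> simp [hij, mul_comm]
  refine Subtype.ext (act_val_eq ?_)
  rw [hd, hn]
  simp only [embPt]
  rw [blk_mul, act_val_mul_denom]
  congr 1
  rw [smul_mul_smul_comm, Matrix.one_mul]
  congr 1
  have hs : (Real.sqrt t.1 : ℂ) ≠ 0 := by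
    exact_mod_cast (Real.sqrt_pos.2 ht).ne'
  have ht2 : (t.1 : ℂ) = Real.sqrt t.1 * Real.sqrt t.1 := by
    rw [← Complex.ofReal_mul, Real.mul_self_sqrt ht.le]
  rw [ht2]
  field_simp

end Embeddings

/-! ### The Siegel operators on modular forms and on `A_h`. -/

section SiegelOperator

variable {V : Type*} [NormedAddCommGroup V] [NormedSpace ℂ V]
variable {m n : ℕ} (h : m < n)

lemma embPt_one_add_smul (Z : SiegelH m) (w : ℂ) :
    (embPt h Z ⟨1, Set.mem_Ioi.2 one_pos⟩).1 + w • (diagonal fun i => (transversal h i : ℂ)) =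
      blk h Z.1 ((Complex.I + w) • 1) := by
  rw [diagonal_transversal, embPt, blk_smul, blk_add]
  simp [add_smul]

/-- The constant term of the Fourier-Jacobi expansion. -/
noncomputable def constTerm (f : SiegelH n → V) (Z : Matrix (Fin m) (Fin m) ℂ) : V :=
  fc (fun w => extZero f (blk h Z ((Complex.I + w) • 1))) 0 1

lemma limitTerm_Q {ρ : GL (Fin n) ℂ →* (V ≃ₗ[ℂ] V)} (f : modForms ρ) (g : Sp m) :
    limitTerm h ρ (Q ρ f) g = fun t => f.1 (embPt h (act g (basePt m)) t) := by
  ext t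
  rw [← act_embSp]
  exact LinearEquiv.apply_symm_apply _ _

variable [FiniteDimensional ℂ V]

lemma tendsto_embPt (hm : 0 < m) {ρ : GL (Fin n) ℂ →* (V ≃ₗ[ℂ] V)} {f : SiegelH n → V} (hf : f ∈ modForms ρ)
    (Z : SiegelH m) :
    Tendsto (fun t => f (embPt h Z t)) atTop (𝓝 (constTerm h f Z.1)) := by
  have hF := koecherData_of_modForms (by omega) hf
  have hlim := hF.tendsto_diagonal (embPt h Z ⟨1, Set.mem_Ioi.2 one_pos⟩).2 (transversal h)
  simp only [embPt_one_add_smul] at hlim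
  -- The ray starts at the point with `t = 1`, whence the shift by one.
  have h1 : Tendsto (fun t : Set.Ioi (0 : ℝ) => t.1 - 1) atTop atTop := by
    rw [tendsto_comp_val_Ioi_atTop (f := fun t : ℝ => t - 1)]
    exact tendsto_atTop_add_const_right _ _ tendsto_id
  refine (hlim.comp h1).congr fun t => ?_
  have e : Complex.I + ((t.1 - 1 : ℝ) : ℂ) * Complex.I = Complex.I * t.1 := by push_cast; ring
  simp only [Function.comp_apply]
  rw [e]
  exact extend_apply f (embPt h Z t).2

lemma siegelPhi_eq_constTerm (hm : 0 < m) {ρ : GL (Fin n) ℂ →* (V ≃ₗ[ℂ] V)} {f : SiegelH n → V}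
    (hf : f ∈ modForms ρ) (Z : SiegelH m) : siegelPhi h f Z = constTerm h f Z.1 :=
  (tendsto_embPt h hm hf Z).limUnder_eq

section holo

attribute [local instance] Matrix.normedAddCommGroup Matrix.normedSpace

/-- The linear map `Z ↦ (Z 0; 0 0)` on symmetric matrices. -/
def blkLinear : SymMat m →ₗ[ℂ] SymMat n where
  toFun Z := ⟨blk h Z.1 0, by
    change (blk h Z.1 0).IsSymm
    rw [IsSymm, blk_transpose, Z.2.eq, transpose_zero]⟩
  map_add' Z Z' := by
    ext1
    change blk h (Z.1 + Z'.1) 0 = blk h Z.1 0 + blk h Z'.1 0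
    rw [blk_add, add_zero]
  map_smul' c Z := by
    ext1
    change blk h (c • Z.1) 0 = c • blk h Z.1 0
    rw [blk_smul, smul_zero]

/-- Holomorphy of the limit needs no locally uniform convergence: the constant term is an integral
of `f` over a segment at fixed height. -/
lemma differentiableOn_constTerm {f : SiegelH n → V} (hf : IsHolo f) :
    DifferentiableOn ℂ (fun Z : SymMat m => constTerm h f Z.1)
      {Z : SymMat m | Z.1 ∈ SiegelH m} := by
  intro Z₀ hZ₀
  have hNs : (blk h (0 : Matrix (Fin m) (Fin m) ℂ) 1).IsSymm := by
    rw [IsSymm, blk_transpose, transpose_zero, transpose_one]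
  set N : SymMat n := ⟨_, hNs⟩
  have hval : ∀ (Z : SymMat m) (x : ℝ),
      (blkLinear h Z + (Complex.I + ((x : ℂ) + (1 : ℝ) * Complex.I)) • N).1 =
      blk h Z.1 ((Complex.I + ((x : ℂ) + (1 : ℝ) * Complex.I)) • 1) := by
    intro Z x
    change blk h Z.1 0 + (Complex.I + ((x : ℂ) + (1 : ℝ) * Complex.I)) • blk h 0 1 = _
    rw [blk_smul, blk_add, smul_zero, add_zero, zero_add]
  have := differentiableAt_integral_of_holomorphic (V := V) (E := SymMat n)
    (f := fun Z : SymMat n => extZero f Z.1) isOpen_siegelH hf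
    (LinearMap.toContinuousLinearMap (blkLinear h))
    (γ := fun x : ℝ => (Complex.I + ((x : ℂ) + (1 : ℝ) * Complex.I)) • N) (by fun_prop)
    (θ := fun x : ℝ => Complex.exp (-(2 * Real.pi * Complex.I * (0 : ℤ) *
      (x + (1 : ℝ) * Complex.I)))) (by fun_prop) Z₀ (fun x _ => by
      change (blkLinear h Z₀ + _ • N).1 ∈ SiegelH n
      rw [hval, ← embPt_one_add_smul h ⟨Z₀.1, hZ₀⟩, diagonal_transversal]
      have hp : (blk h (0 : Matrix (Fin m) (Fin m) ℝ) 1).PosSemidef := by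
        rw [← diagonal_zero, ← diagonal_one, blk_diagonal]
        refine PosSemidef.diagonal fun i => ?_
        rcases (splitEquiv h).symm i with a | a <;> simp
      have hmap : (blk h (0 : Matrix (Fin m) (Fin m) ℝ) 1).map Complex.ofReal = blk h 0 1 := by
        rw [blk_map _ _ Complex.ofReal_zero]; simp
      rw [← hmap]
      exact add_smul_mem_siegelH (Subtype.property _) hp (by simp))
  refine (this.congr_of_eventuallyEq (Eventually.of_forall fun Z => ?_)).differentiableWithinAt
  refine intervalIntegral.integral_congr fun x _ => ?_
  change _ • extZero f _ = _ • extZero f (blkLinear h Z + _ • N).1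
  rw [hval]

end holo

/-- The transformation law of `f` under the embedded group passes to the limit because the factor
`ρ_n(CZ+D 0; 0 I) = ρ_m(CZ+D)` does not depend on `t`. -/
lemma siegelPhi_mem (hm : 0 < m) (ρ : StableRep V) {f : SiegelH n → V} (hf : f ∈ modForms (ρ.rep n)) :
    siegelPhi h f ∈ modForms (ρ.rep m) := by
  refine ⟨?_, ?_, ?_⟩
  · refine (differentiableOn_constTerm h hf.1).congr fun Z hZ => ?_
    rw [extend_apply _ hZ, siegelPhi_eq_constTerm h hm hf]
  · intro γ Z
    obtain ⟨M, hM⟩ := γ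
    obtain ⟨A, B, C, D, rfl⟩ : ∃ A B C D, M = fromBlocks A B C D :=
      ⟨_, _, _, _, (fromBlocks_toBlocks M).symm⟩
    have h1 := tendsto_embPt h hm hf (act (ofInt ⟨_, hM⟩) Z)
    rw [← siegelPhi_eq_constTerm h hm hf] at h1
    have h2 := tendsto_embPt h hm hf Z
    rw [← siegelPhi_eq_constTerm h hm hf] at h2
    have hcont : Continuous (autJ (ρ.rep m) (ofInt ⟨_, hM⟩) Z) :=
      LinearMap.continuous_of_finiteDimensional
        (autJ (ρ.rep m) (ofInt ⟨_, hM⟩) Z : V →ₗ[ℂ] V)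
    refine tendsto_nhds_unique h1 (((hcont.tendsto _).comp h2).congr fun t => ?_)
    rw [← act_embInt, hf.2.1, Function.comp_apply]
    have hgl : denomGL (ofInt ⟨_, embInt_mem h hM⟩) (embPt h Z t) =
        embGL h (denomGL (ofInt ⟨_, hM⟩) Z) := Units.ext (denom_embInt h hM Z t)
    rw [autJ, autJ, hgl, ρ.compat_GL h]
  · rintro rfl Y₀ hY₀
    have hF := koecherData_of_modForms (by omega) hf
    have hY : (blk h Y₀ 1).PosDef := by
      have e : Y₀ = diagonal fun a => Y₀ a a := by
        ext i j
        have hi := Subsingleton.elim i j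
        subst hi
        simp
      rw [e, ← diagonal_one, blk_diagonal]
      refine PosDef.diagonal fun i => ?_
      rcases (splitEquiv h).symm i with a | a
      · exact hY₀.diag_pos
      · exact one_pos
    obtain ⟨C, hC⟩ := exists_bound_of_isCompact_im hF.holo hF.period
      -- For `m = 1`, `Im Z ≥ Y₀` and `t ≥ 1` make `diag(Im Z, t I)` a diagonal increase of
      -- `diag(Y₀, I)`, so the bound on this one slice serves all such `Z` and `t`.
      (K := {blk h Y₀ 1}) isCompact_singleton (by rintro _ rfl; exact hY)
    refine ⟨C, fun Z hZ => ?_⟩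
    have h1 := (tendsto_embPt h hm hf Z).norm
    rw [← siegelPhi_eq_constTerm h hm hf] at h1
    refine le_of_tendsto h1 ?_
    filter_upwards [eventually_ge_atTop (⟨1, Set.mem_Ioi.2 one_pos⟩ : Set.Ioi (0 : ℝ))] with t ht
    have ht1 : (1 : ℝ) ≤ t.1 := ht
    have := hF.norm_le_add_diagonal hY (C := C) (fun Z hZ h => hC Z hZ h)
      (t := fun i => Sum.elim (fun a => (Z.1 a a).im - Y₀ a a) (fun _ => t.1 - 1)
        ((splitEquiv h).symm i)) (fun i => by
          rcases (splitEquiv h).symm i with a | a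
          · simpa using hZ.diag_nonneg (i := a)
          · simpa using ht1) (embPt h Z t).2 ?_
    · rwa [extZero, extend_apply _ (Subtype.property _)] at this
    · rw [← blk_diagonal, blk_add, embPt, blk_map _ _ Complex.zero_im]
      congr 1
      · ext i j
        have hi := Subsingleton.elim i j
        subst hi
        simp
      · ext i j
        by_cases hij : i = j <;> simp [hij]

/-- The classical Siegel operator as a linear map on modular forms. -/
noncomputable def siegelPhiLinear (hm : 0 < m) (ρ : StableRep V) :
    modForms (ρ.rep n) →ₗ[ℂ] modForms (ρ.rep m) where
  toFun f := ⟨siegelPhi h f.1, siegelPhi_mem h hm ρ f.2⟩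
  map_add' f f' := by
    ext Z
    exact ((tendsto_embPt h hm f.2 Z).add (tendsto_embPt h hm f'.2 Z)).limUnder_eq.trans (by
      rw [← siegelPhi_eq_constTerm h hm f.2, ← siegelPhi_eq_constTerm h hm f'.2]; rfl)
  map_smul' c f := by
    ext Z
    exact ((tendsto_embPt h hm f.2 Z).const_smul c).limUnder_eq.trans (by
      rw [← siegelPhi_eq_constTerm h hm f.2]; rfl)

lemma siegelL_Q (hm : 0 < m) (ρ : StableRep V) (f : modForms (ρ.rep n)) :
    siegelL h ρ (Q (ρ.rep n) f) = Q (ρ.rep m) (siegelPhiLinear h hm ρ f) := by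
  ext g
  rw [siegelL, limitTerm_Q]
  rfl

/-- The Siegel operator as a linear map on the spaces `A_h`. -/
noncomputable def siegelLLinear (hm : 0 < m) (ρ : StableRep V) : Ah (ρ.rep n) →ₗ[ℂ] Ah (ρ.rep m) where
  toFun F := ⟨siegelL h ρ F.1, by
    obtain ⟨f, hf⟩ := F.2
    exact ⟨siegelPhiLinear h hm ρ f, by rw [← siegelL_Q, hf]⟩⟩
  map_add' := by
    -- Linearity is carried over from `Φ` through `siegelL_Q`. Injectivity of `Q` is not needed,
    -- since `siegelL` is defined on functions on the group.
    rintro ⟨_, f, rfl⟩ ⟨_, f', rfl⟩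
    ext1
    change siegelL h ρ (Q _ f + Q _ f') = siegelL h ρ (Q _ f) + siegelL h ρ (Q _ f')
    rw [← map_add, siegelL_Q h hm, siegelL_Q h hm, siegelL_Q h hm, map_add, map_add]
  map_smul' := by
    rintro c ⟨_, f, rfl⟩
    ext1
    change siegelL h ρ (c • Q _ f) = c • siegelL h ρ (Q _ f)
    rw [← map_smul, siegelL_Q h hm, siegelL_Q h hm, map_smul, map_smul]

end SiegelOperator

end StableSiegel

theorem proposition4p1 {V : Type*} [NormedAddCommGroup V] [NormedSpace ℂ V]
    [FiniteDimensional ℂ V] (ρ : StableSiegel.StableRep V) {m n : ℕ} (hm : 0 < m) (h : m < n) :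
    -- the limit defining `L_{m,n}` exists on `A_h(ρ_n)`
    (∀ F ∈ StableSiegel.Ah (ρ.rep n), ∀ g : StableSiegel.Sp m,
      ∃ ℓ : V, Tendsto (StableSiegel.limitTerm h (ρ.rep n) F g) atTop (𝓝 ℓ)) ∧
    -- the limit defining `Φ_{m,n}` exists on `[Γ_n, ρ_n]`
    (∀ f ∈ StableSiegel.modForms (ρ.rep n), ∀ Z : StableSiegel.SiegelH m,
      ∃ ℓ : V, Tendsto (fun t => f (StableSiegel.embPt h Z t)) atTop (𝓝 ℓ)) ∧
    -- `L_{m,n}` is a linear map of `A_h(ρ_n)` into `A_h(ρ_m)`, and `L ∘ Q_n = Q_m ∘ Φ`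
    ∃ L : StableSiegel.Ah (ρ.rep n) →ₗ[ℂ] StableSiegel.Ah (ρ.rep m),
      (∀ F : StableSiegel.Ah (ρ.rep n),
        (L F : StableSiegel.Sp m → V) =
          StableSiegel.siegelL h ρ (F : StableSiegel.Sp n → V)) ∧
      ∃ Φ : StableSiegel.modForms (ρ.rep n) →ₗ[ℂ] StableSiegel.modForms (ρ.rep m),
        (∀ f : StableSiegel.modForms (ρ.rep n),
          (Φ f : StableSiegel.SiegelH m → V) =
            StableSiegel.siegelPhi h (f : StableSiegel.SiegelH n → V)) ∧
        L ∘ₗ StableSiegel.QAh (ρ.rep n) = StableSiegel.QAh (ρ.rep m) ∘ₗ Φ := by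
  refine ⟨?_, fun f hf Z => ⟨_, StableSiegel.tendsto_embPt h hm hf Z⟩,
    StableSiegel.siegelLLinear h hm ρ, fun F => rfl, StableSiegel.siegelPhiLinear h hm ρ,
    fun f => rfl, ?_⟩
  · rintro _ ⟨f, rfl⟩ g
    rw [StableSiegel.limitTerm_Q]
    exact ⟨_, StableSiegel.tendsto_embPt h hm f.2 _⟩
  · ext1 f
    exact Subtype.ext (StableSiegel.siegelL_Q h hm ρ f)
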